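/- Let $I$ be a finite set, let $B=(b_{ij})_{i,j\in I}$ be a skew-symmetrizable integer matrix, and let $\sigma$ be an admissible automorphism of $B$: a permutation of $I$ such that $b_{\sigma(i)\sigma(j)}=b_{ij}$ for all $i,j\in I$ and such that, for all $i_1,i_2$ in the same $\sigma$-orbit and all $j\in I$, $b_{i_1j}\,b_{i_2j}\ge 0$ and $b_{i_1i_2}=0$. Write $\overline{\imath}$ for the $\sigma$-orbit of $i$. The folded matrix $\pi(B)=(b_{\overline{\imath}\,\overline{\jmath}})$, indexed by the set $I/\sigma$ of orbits, is given by $b_{\overline{\imath}\,\overline{\jmath}}=\sum_{s\in\overline{\imath}}b_{sj}$, which does not depend on the representative $j$ of $\overline{\jmath}$. The Cartan counterpart $A(M)=(a_{ij})$ of a square integer matrix $M=(m_{ij})$ is given by $a_{ii}=2$ and $a_{ij}=-|m_{ij}|$ for $i\ne j$. For a Cartan counterpart $A$, let $\Delta(A)$ be the root system of the Kac–Moody algebra $\mathfrak g(A)$ over $\mathbb{C}$, i.e. the set of all (real and imaginary) roots, viewed as a subset of the root lattice, which is the free abelian group on the simple roots. Put $A=A(B)$ and $\overline{A}=A(\pi(B))$,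 and let $\{\alpha_i\}_{i\in I}$ and $\{\alpha_{\overline{\imath}}\}_{\overline{\imath}\in I/\sigma}$ be the simple roots of $\Delta(A)$ and $\Delta(\overline{A})$ respectively. Let $\pi$ be the linear map from the root lattice of $\Delta(A)$ to the root lattice of $\Delta(\overline{A})$ with $\pi(\alpha_i)=\alpha_{\overline{\imath}}$ for all $i\in I$. Then $\pi(\alpha)\in\Delta(\overline{A})$ for every $\alpha\in\Delta(A)$. -/

import Mathlib

/-! ## Exchange matrices, automorphisms and folding -/

section Folding

variable {I : Type*}

/-- `B` is skew-symmetrizable: `D * B` is skew-symmetric for some diagonal matrix `D` with positive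
integer diagonal entries. -/
def IsSkewSymmetrizable (B : Matrix I I ℤ) : Prop :=
  ∃ d : I → ℤ, (∀ i, 0 < d i) ∧ ∀ i j, d i * B i j = -(d j * B j i)

/-- The Cartan counterpart `A(B)` of `B`. -/
def cartanCounterpart [DecidableEq I] (B : Matrix I I ℤ) : Matrix I I ℤ :=
  Matrix.of fun i j => if i = j then 2 else -|B i j|

/-- The permutation `σ` is an automorphism of `B`. -/
def IsMatrixAut (B : Matrix I I ℤ) (σ : Equiv.Perm I) : Prop :=
  ∀ i j, B (σ i) (σ j) = B i j

/-- The permutation `σ` is an admissible automorphism of `B`. -/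
structure IsAdmissible (B : Matrix I I ℤ) (σ : Equiv.Perm I) : Prop where
  isAut : IsMatrixAut B σ
  mul_nonneg : ∀ i₁ i₂ j, σ.SameCycle i₁ i₂ → 0 ≤ B i₁ j * B i₂ j
  eq_zero : ∀ i₁ i₂, σ.SameCycle i₁ i₂ → B i₁ i₂ = 0

/-- The set `I/σ` of orbits of the permutation `σ`. -/
def Orbit (σ : Equiv.Perm I) : Type _ := Quotient (Equiv.Perm.SameCycle.setoid σ)

/-- The orbit of `i`. -/
def Orbit.mk (σ : Equiv.Perm I) (i : I) : Orbit σ :=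
  Quotient.mk (Equiv.Perm.SameCycle.setoid σ) i

noncomputable instance (σ : Equiv.Perm I) : DecidableEq (Orbit σ) := Classical.decEq _

noncomputable instance [Finite I] (σ : Equiv.Perm I) : Fintype (Orbit σ) :=
  haveI : Finite (Orbit σ) := Quotient.finite _
  Fintype.ofFinite _

theorem Orbit.mk_eq_mk (σ : Equiv.Perm I) (i j : I) :
    Orbit.mk σ i = Orbit.mk σ j ↔ σ.SameCycle i j :=
  ⟨fun h => Quotient.exact h, fun h => Quotient.sound h⟩

theorem Orbit.mk_apply (σ : Equiv.Perm I) (i : I) : Orbit.mk σ (σ i) = Orbit.mk σ i :=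
  (Orbit.mk_eq_mk σ _ _).2 (Equiv.Perm.sameCycle_apply_left.2 (Equiv.Perm.SameCycle.refl σ i))

/-- The sum of the entries `b_{sj}` over all `s` in the orbit `x`. -/
noncomputable def orbitSum [Fintype I] (B : Matrix I I ℤ) (σ : Equiv.Perm I)
    (x : Orbit σ) (j : I) : ℤ :=
  ∑ s ∈ Finset.univ.filter (fun s => Orbit.mk σ s = x), B s j

theorem orbitSum_apply [Fintype I] {B : Matrix I I ℤ} {σ : Equiv.Perm I}
    (h : IsMatrixAut B σ) (x : Orbit σ) (j : I) :
    orbitSum B σ x (σ j) = orbitSum B σ x j := by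
  unfold orbitSum
  symm
  refine Finset.sum_equiv σ (fun s => ?_) (fun s _ => (h s j).symm)
  simp [Orbit.mk_apply]

theorem orbitSum_eq_of_sameCycle [Fintype I] {B : Matrix I I ℤ} {σ : Equiv.Perm I}
    (h : IsMatrixAut B σ) (x : Orbit σ) {j k : I} (hjk : σ.SameCycle j k) :
    orbitSum B σ x j = orbitSum B σ x k := by
  obtain ⟨n, -, hn⟩ := hjk.exists_pow_eq' 
  subst hn
  induction n with
  | zero => simp
  | succ n ih =>
    rw [pow_succ', Equiv.Perm.mul_apply, orbitSum_apply h]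
    exact ih ⟨n, by simp⟩

/-- The folded matrix `π(B)`, indexed by the orbits of `σ`: its `(x, y)` entry is the sum of
`b_{sj}` over all `s` in `x`, for any representative `j` of `y`. -/
noncomputable def foldedMatrix [Fintype I] (B : Matrix I I ℤ) (σ : Equiv.Perm I)
    (h : IsMatrixAut B σ) : Matrix (Orbit σ) (Orbit σ) ℤ :=
  Matrix.of fun x y => Quotient.lift (orbitSum B σ x)
    (fun _ _ hjk => orbitSum_eq_of_sameCycle h x hjk) y

/-- The linear map of root lattices with `α_i ↦ α_{ī}`. The root lattice with simple roots indexed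
by `I` is the free abelian group `I →₀ ℤ`, and `α_i` is `Finsupp.single i 1`. -/
noncomputable def foldRootLattice (σ : Equiv.Perm I) : (I →₀ ℤ) →ₗ[ℤ] (Orbit σ →₀ ℤ) :=
  Finsupp.lmapDomain ℤ ℤ (Orbit.mk σ)

end Folding

/-! ## Kac–Moody algebras and their root systems -/

namespace KacMoody

variable {I : Type*} [Fintype I]

/-- A realization `(𝔥, Π, Π^∨)` over `ℂ` of an integer square matrix `A`. -/
structure Realization (A : Matrix I I ℤ) (𝔥 : Type*) [AddCommGroup 𝔥] [Module ℂ 𝔥] where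
  /-- the simple coroots `α_i^∨` -/
  coroot : I → 𝔥
  /-- the simple roots `α_i` -/
  root : I → Module.Dual ℂ 𝔥
  linearIndependent_coroot : LinearIndependent ℂ coroot
  linearIndependent_root : LinearIndependent ℂ root
  root_coroot : ∀ i j, root j (coroot i) = (A i j : ℂ)
  finiteDimensional : FiniteDimensional ℂ 𝔥
  finrank_add_rank :
    Module.finrank ℂ 𝔥 + (A.map (Int.cast : ℤ → ℂ)).rank = 2 * Fintype.card I

/-- Every matrix has a realization. -/
theorem Realization.exists_realization (A : Matrix I I ℤ) :
    Nonempty (Realization A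
      ((I → ℂ) × ((I → ℂ) ⧸ LinearMap.range (A.map (Int.cast : ℤ → ℂ)).transpose.mulVecLin))) := by
  classical
  set M : Matrix I I ℂ := A.map (Int.cast : ℤ → ℂ)
  set W : Submodule ℂ (I → ℂ) := LinearMap.range M.transpose.mulVecLin with hW
  obtain ⟨s, hs⟩ := W.mkQ.exists_rightInverse_of_surjective W.range_mkQ
  let φ : ((I → ℂ) × ((I → ℂ) ⧸ W)) →ₗ[ℂ] (I → ℂ) := M.transpose.mulVecLin.coprod s
  have hφ : Function.Surjective φ := by
    intro v
    have h1 : W.mkQ (s (W.mkQ v)) = W.mkQ v := LinearMap.congr_fun hs (W.mkQ v)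
    have h2 : v - s (W.mkQ v) ∈ W := by
      have h3 : v - s (W.mkQ v) ∈ LinearMap.ker W.mkQ := by
        rw [LinearMap.mem_ker, map_sub, h1, sub_self]
      rwa [Submodule.ker_mkQ] at h3
    obtain ⟨u, hu⟩ := h2
    exact ⟨(u, W.mkQ v), by simp only [φ, LinearMap.coprod_apply, hu]; abel⟩
  refine ⟨{
    coroot := fun i => (Pi.single i 1, 0)
    root := fun j => LinearMap.proj j ∘ₗ φ
    linearIndependent_coroot := ?_
    linearIndependent_root := ?_
    root_coroot := ?_
    finiteDimensional := inferInstance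
    finrank_add_rank := ?_ }⟩
  · rw [Fintype.linearIndependent_iff]
    intro g hg i
    have := congrFun (congrArg Prod.fst hg) i
    simpa [Prod.fst_sum, Pi.single_apply] using this
  · rw [Fintype.linearIndependent_iff]
    intro g hg i
    obtain ⟨x, hx⟩ := hφ (Pi.single i 1)
    have := LinearMap.congr_fun hg x
    simpa [hx, Pi.single_apply] using this
  · intro i j
    simp [φ, M]
  · have h1 := W.finrank_quotient_add_finrank
    have h2 : Module.finrank ℂ W = M.rank := by
      rw [← Matrix.rank_transpose]; rfl
    rw [Module.finrank_prod]
    simp only [Module.finrank_fintype_fun_eq_card] at h1 ⊢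
    change _ + M.rank = _
    omega

/-- Generators of the auxiliary algebra: the `e_i`, the `f_i`, and the elements of `𝔥`. -/
inductive Generator (I 𝔥 : Type*)
  | e : I → Generator I 𝔥
  | f : I → Generator I 𝔥
  | h : 𝔥 → Generator I 𝔥

noncomputable section

/-- The generator `e_i` of the free Lie algebra. -/
abbrev freeE (𝔥 : Type*) (i : I) : FreeLieAlgebra ℂ (Generator I 𝔥) :=
  FreeLieAlgebra.of ℂ (Generator.e i)

/-- The generator `f_i` of the free Lie algebra. -/
abbrev freeF (𝔥 : Type*) (i : I) : FreeLieAlgebra ℂ (Generator I 𝔥) :=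
  FreeLieAlgebra.of ℂ (Generator.f i)

/-- The generator of the free Lie algebra given by an element of `𝔥`. -/
abbrev freeH (I : Type*) {𝔥 : Type*} (x : 𝔥) : FreeLieAlgebra ℂ (Generator I 𝔥) :=
  FreeLieAlgebra.of ℂ (Generator.h x)

variable {A : Matrix I I ℤ} {𝔥 : Type*} [AddCommGroup 𝔥] [Module ℂ 𝔥] (R : Realization A 𝔥)

namespace Realization

/-- The defining relations of the auxiliary algebra: `Rel x y` means that `x = y` is imposed. The
relations `h_add` and `h_smul` say that `𝔥` is mapped linearly. -/
inductive Rel :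
    FreeLieAlgebra ℂ (Generator I 𝔥) → FreeLieAlgebra ℂ (Generator I 𝔥) → Prop
  | h_add (x y : 𝔥) : Rel (freeH I (x + y)) (freeH I x + freeH I y)
  | h_smul (c : ℂ) (x : 𝔥) : Rel (freeH I (c • x)) (c • freeH I x)
  | e_f_same (i : I) : Rel ⁅freeE 𝔥 i, freeF 𝔥 i⁆ (freeH I (R.coroot i))
  | e_f_ne (i j : I) (hij : i ≠ j) : Rel ⁅freeE 𝔥 i, freeF 𝔥 j⁆ 0
  | h_h (x y : 𝔥) : Rel ⁅freeH I x, freeH I y⁆ 0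
  | h_e (x : 𝔥) (i : I) : Rel ⁅freeH I x, freeE 𝔥 i⁆ (R.root i x • freeE 𝔥 i)
  | h_f (x : 𝔥) (i : I) : Rel ⁅freeH I x, freeF 𝔥 i⁆ (-(R.root i x • freeF 𝔥 i))

/-- The ideal of the free Lie algebra generated by the defining relations. -/
def relIdeal : LieIdeal ℂ (FreeLieAlgebra ℂ (Generator I 𝔥)) :=
  LieSubmodule.lieSpan ℂ _ {z | ∃ x y, R.Rel x y ∧ z = x - y}

/-- The auxiliary Lie algebra `𝔤̃(A)`. -/
def AuxAlgebra : Type _ := FreeLieAlgebra ℂ (Generator I 𝔥) ⧸ R.relIdeal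
deriving LieRing, LieAlgebra ℂ

/-- The canonical image of an element of `𝔥` in `𝔤̃(A)`. -/
def auxCartan (x : 𝔥) : R.AuxAlgebra :=
  LieSubmodule.Quotient.mk (N := R.relIdeal) (freeH I x)

/-- The maximal ideal `𝔯` of `𝔤̃(A)` among those that intersect the image of `𝔥` trivially: the sum
of all these ideals. -/
def radical : LieIdeal ℂ R.AuxAlgebra :=
  sSup {J | ∀ x : 𝔥, R.auxCartan x ∈ J → R.auxCartan x = 0}

/-- The Kac–Moody algebra `𝔤(A) = 𝔤̃(A)/𝔯`. -/
def KMAlgebra : Type _ := R.AuxAlgebra ⧸ R.radical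
deriving LieRing, LieAlgebra ℂ

/-- The canonical image of an element of `𝔥` in `𝔤(A)`. -/
def cartan (x : 𝔥) : R.KMAlgebra :=
  LieSubmodule.Quotient.mk (N := R.radical) (R.auxCartan x)

/-- The linear form on `𝔥` given by an element `∑ c_i α_i` of the root lattice. -/
def weight (α : I →₀ ℤ) : Module.Dual ℂ 𝔥 := α.sum fun i c => c • R.root i

/-- The root system `Δ(A)` of `𝔤(A)`: the nonzero elements `α` of the root lattice whose root space
`{x ∈ 𝔤(A) | [h, x] = α(h) x for all h ∈ 𝔥}` is nonzero. -/
def rootSystem : Set (I →₀ ℤ) :=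
  {α | α ≠ 0 ∧ ∃ x : R.KMAlgebra, x ≠ 0 ∧ ∀ h : 𝔥, ⁅R.cartan h, x⁆ = R.weight α h • x}

end Realization

end

end KacMoody

/-!
Let `ā_{xy}` be the entries of the Cartan counterpart of the folded matrix. Admissibility of `σ`
gives `ā_{xy} = ∑_{s ∈ x} a_{sj}` for every `j ∈ y`, including the case `x = y`
(`IsAdmissible.cartanCounterpart_foldedMatrix`). Hence
`⟨π(α), α_x^∨⟩ = ∑_{s ∈ x} ⟨α, α_s^∨⟩`, and the simple reflection at an orbit `x` lifts through `π`
to the product of the commuting reflections at the elements of `x`.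

Let `α` be a positive root of `𝔤(A)`; the proof is by induction on its height. The support of `α` is
connected, hence so is that of `π(α)`. If `⟨π(α), α_x^∨⟩ ≤ 0` for all `x`, then `π(α)` lies in Kac's
fundamental set and is a root (`IsKacMoody.mem_roots_of_pairing_nonpos`). Otherwise
`⟨π(α), α_x^∨⟩ > 0` for some `x`, and the product of the reflections at the elements of `x` sends
`α` to a root of smaller height. If this root is positive, the induction hypothesis applies to it, and
`π(α)` is the reflection at `x` of its image. If it is negative, the support of `α` is contained in
`x`; it is connected and no two elements of `x` are adjacent, so that `α` is simple.

The facts about Kac–Moody algebras used here are proved for a Lie algebra with Chevalley generators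
in which `𝔥` embeds and no nonzero ideal meets `𝔥` trivially
(`ChevalleyGenerators.IsKacMoody`). These assumptions are unchanged when the `e_i` and `f_i` are
exchanged, which reduces negative roots to positive ones. The algebra `𝔤(A)` satisfies them by the
triangular decomposition of `𝔤̃(A)` and the action of `𝔤̃(A)` on highest weight modules with basis
the words in `I`. Root vectors of positive roots come from iterated brackets of the `e_i`. The
absence of ideals gives the Serre relations, hence the local nilpotency of `ad e_i` and, with the
representation theory of `𝔰𝔩₂`, the invariance under simple reflections.
-/

namespace KacMoody

noncomputable section

variable {I : Type*} [Fintype I] {A : Matrix I I ℤ} {𝔥 : Type*} [AddCommGroup 𝔥] [Module ℂ 𝔥]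

/-! ### Weights -/

/-- The value of the linear form `α` on the simple coroot `α_i^∨`, as an integer. -/
def pairing (A : Matrix I I ℤ) (α : I →₀ ℤ) (i : I) : ℤ := ∑ j, α j * A i j

namespace Realization

variable (R : Realization A 𝔥)

@[simp]
theorem weight_zero : R.weight 0 = 0 := by simp [weight]

theorem weight_add (α β : I →₀ ℤ) : R.weight (α + β) = R.weight α + R.weight β := by
  classical
  exact Finsupp.sum_add_index' (fun _ => zero_smul ℤ _) fun _ _ _ => add_smul _ _ _

theorem weight_neg (α : I →₀ ℤ) : R.weight (-α) = -R.weight α :=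
  eq_neg_of_add_eq_zero_left (by rw [← weight_add]; simp)

theorem weight_single (i : I) : R.weight (Finsupp.single i 1) = R.root i := by
  simp [weight]

theorem weight_eq_sum (α : I →₀ ℤ) : R.weight α = ∑ i, ((α i : ℤ) : ℂ) • R.root i := by
  rw [weight, Finsupp.sum_fintype _ _ (fun _ => by simp)]
  exact Finset.sum_congr rfl fun i _ => (Int.cast_smul_eq_zsmul ℂ _ _).symm

theorem weight_injective : Function.Injective R.weight := by
  intro α β hαβ
  have h := (Fintype.linearIndependent_iff.1 R.linearIndependent_root)
    (fun i => ((α i - β i : ℤ) : ℂ)) ?_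
  · ext i
    have := h i
    rw [Int.cast_eq_zero] at this
    omega
  · rw [weight_eq_sum, weight_eq_sum, ← sub_eq_zero, ← Finset.sum_sub_distrib] at hαβ
    simpa [sub_smul] using hαβ

theorem weight_coroot (α : I →₀ ℤ) (i : I) :
    R.weight α (R.coroot i) = (pairing A α i : ℂ) := by
  rw [weight_eq_sum]
  simp [pairing, R.root_coroot]

end Realization

/-! ### Lie algebras with Chevalley generators -/

/-- Generators `e_i`, `f_i` and `H(x)`, for `x ∈ 𝔥`, of a Lie algebra `L` that satisfy the defining
relations of `𝔤̃(A)`; equivalently, a surjective homomorphism from `𝔤̃(A)` to `L`. -/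
structure ChevalleyGenerators (R : Realization A 𝔥) (L : Type*) [LieRing L] [LieAlgebra ℂ L] where
  /-- the generators `e_i` -/
  e : I → L
  /-- the generators `f_i` -/
  f : I → L
  /-- the linear map from `𝔥` to `L` -/
  H : 𝔥 →ₗ[ℂ] L
  e_f_same : ∀ i, ⁅e i, f i⁆ = H (R.coroot i)
  e_f_ne : ∀ i j, i ≠ j → ⁅e i, f j⁆ = 0
  H_H : ∀ x y, ⁅H x, H y⁆ = 0
  H_e : ∀ x i, ⁅H x, e i⁆ = R.root i x • e i
  H_f : ∀ x i, ⁅H x, f i⁆ = -(R.root i x • f i)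
  lieSpan_eq_top :
    LieSubalgebra.lieSpan ℂ L (Set.range e ∪ Set.range f ∪ Set.range H) = ⊤

namespace ChevalleyGenerators

variable {R : Realization A 𝔥} {L : Type*} [LieRing L] [LieAlgebra ℂ L]
  (D : ChevalleyGenerators R L)

/-- The generators `f_i`, `e_i`, `-H(x)`: exchanging positive and negative roots this way does not
require the Chevalley involution to be known to exist on `L`. -/
def swap : ChevalleyGenerators R L where
  e := D.f
  f := D.e
  H := -D.H
  e_f_same i := by rw [← lie_skew, D.e_f_same]; rfl
  e_f_ne i j hij := by rw [← lie_skew, D.e_f_ne j i hij.symm, neg_zero]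
  H_H x y := by simp [D.H_H]
  H_e x i := by simp [D.H_f]
  H_f x i := by simp [D.H_e]
  lieSpan_eq_top := by
    rw [← D.lieSpan_eq_top]
    have h : Set.range ⇑(-D.H) = Set.range ⇑D.H := by
      ext z
      constructor
      · rintro ⟨x, rfl⟩
        exact ⟨-x, by simp⟩
      · rintro ⟨x, rfl⟩
        exact ⟨-x, by simp⟩
    rw [h, Set.union_comm (Set.range D.f)]

@[simp] theorem swap_e : D.swap.e = D.f := rfl
@[simp] theorem swap_f : D.swap.f = D.e := rfl
@[simp] theorem swap_H : D.swap.H = -D.H := rfl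

theorem lie_mem_of_forall_generator {T : Submodule ℂ L}
    (he : ∀ i, ∀ y ∈ T, ⁅D.e i, y⁆ ∈ T) (hf : ∀ i, ∀ y ∈ T, ⁅D.f i, y⁆ ∈ T)
    (hH : ∀ x, ∀ y ∈ T, ⁅D.H x, y⁆ ∈ T) (z : L) : ∀ y ∈ T, ⁅z, y⁆ ∈ T := by
  have hz : z ∈ LieSubalgebra.lieSpan ℂ L (Set.range D.e ∪ Set.range D.f ∪ Set.range D.H) := by
    rw [D.lieSpan_eq_top]; trivial
  induction hz using LieSubalgebra.lieSpan_induction with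
  | mem x hx =>
    rcases hx with (⟨i, rfl⟩ | ⟨i, rfl⟩) | ⟨x, rfl⟩
    exacts [he i, hf i, hH x]
  | zero => intro y _; simp
  | add a b _ _ ha hb => intro y hy; rw [add_lie]; exact add_mem (ha y hy) (hb y hy)
  | smul c a _ ha => intro y hy; rw [smul_lie]; exact T.smul_mem _ (ha y hy)
  | lie a b _ _ ha hb =>
    intro y hy
    rw [lie_lie]
    exact sub_mem (ha _ (hb y hy)) (hb _ (ha y hy))

theorem eq_top_of_forall_generator {T : Submodule ℂ L}
    (he : ∀ i, D.e i ∈ T) (hf : ∀ i, D.f i ∈ T) (hH : ∀ x, D.H x ∈ T)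
    (he' : ∀ i, ∀ y ∈ T, ⁅D.e i, y⁆ ∈ T) (hf' : ∀ i, ∀ y ∈ T, ⁅D.f i, y⁆ ∈ T)
    (hH' : ∀ x, ∀ y ∈ T, ⁅D.H x, y⁆ ∈ T) : T = ⊤ := by
  rw [eq_top_iff]
  intro z _
  have hz : z ∈ LieSubalgebra.lieSpan ℂ L (Set.range D.e ∪ Set.range D.f ∪ Set.range D.H) := by
    rw [D.lieSpan_eq_top]; trivial
  induction hz using LieSubalgebra.lieSpan_induction with
  | mem x hx =>
    rcases hx with (⟨i, rfl⟩ | ⟨i, rfl⟩) | ⟨x, rfl⟩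
    exacts [he i, hf i, hH x]
  | zero => exact zero_mem _
  | add a b _ _ ha hb => exact add_mem (ha trivial) (hb trivial)
  | smul c a _ ha => exact T.smul_mem _ (ha trivial)
  | lie a b _ _ _ hb => exact D.lie_mem_of_forall_generator he' hf' hH' a b (hb trivial)

/-! ### Weight spaces -/

/-- The space of vectors of weight `α` for the action of `𝔥` through `H`. -/
def weightSpace (α : I →₀ ℤ) : Submodule ℂ L where
  carrier := {x | ∀ h, ⁅D.H h, x⁆ = R.weight α h • x}
  add_mem' {x y} hx hy h := by rw [lie_add, hx h, hy h, smul_add]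
  zero_mem' h := by simp
  smul_mem' c x hx h := by rw [lie_smul, hx h, smul_comm]

theorem mem_weightSpace {α : I →₀ ℤ} {x : L} :
    x ∈ D.weightSpace α ↔ ∀ h, ⁅D.H h, x⁆ = R.weight α h • x := Iff.rfl

theorem e_mem_weightSpace (i : I) : D.e i ∈ D.weightSpace (Finsupp.single i 1) := fun h => by
  rw [R.weight_single, D.H_e]

theorem H_mem_weightSpace (x : 𝔥) : D.H x ∈ D.weightSpace 0 := fun h => by simp [D.H_H]

theorem mem_weightSpace_swap {α : I →₀ ℤ} {x : L} :
    x ∈ D.swap.weightSpace α ↔ x ∈ D.weightSpace (-α) := by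
  simp only [mem_weightSpace, swap_H, R.weight_neg, LinearMap.neg_apply, neg_lie, neg_smul]
  exact forall_congr' fun h => neg_eq_iff_eq_neg

theorem lie_mem_weightSpace {α β : I →₀ ℤ} {x y : L} (hx : x ∈ D.weightSpace α)
    (hy : y ∈ D.weightSpace β) : ⁅x, y⁆ ∈ D.weightSpace (α + β) := fun h => by
  rw [leibniz_lie, hx h, hy h, R.weight_add, smul_lie, lie_smul, LinearMap.add_apply, add_smul]

theorem lie_e_mem_weightSpace (i : I) {α : I →₀ ℤ} {x : L} (hx : x ∈ D.weightSpace α) :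
    ⁅D.e i, x⁆ ∈ D.weightSpace (α + Finsupp.single i 1) := by
  rw [add_comm]
  exact D.lie_mem_weightSpace (D.e_mem_weightSpace i) hx

theorem lie_f_mem_weightSpace (i : I) {α : I →₀ ℤ} {x : L} (hx : x ∈ D.weightSpace α) :
    ⁅D.f i, x⁆ ∈ D.weightSpace (α - Finsupp.single i 1) := by
  have h := D.swap.lie_e_mem_weightSpace i (α := -α) (x := x)
    ((D.mem_weightSpace_swap).2 (by rwa [neg_neg]))
  rw [mem_weightSpace_swap] at h
  have h1 : α - Finsupp.single i 1 = -(-α + Finsupp.single i 1) := by abel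
  rw [h1]
  exact h

/-- An `𝔥`-stable subspace contains the weight components of its elements. -/
theorem mem_of_sum_mem {J : Submodule ℂ L} (hJ : ∀ h, ∀ x ∈ J, ⁅D.H h, x⁆ ∈ J)
    (s : Finset (I →₀ ℤ)) (y : (I →₀ ℤ) → L) (hy : ∀ α ∈ s, y α ∈ D.weightSpace α)
    (hs : ∑ α ∈ s, y α ∈ J) : ∀ α ∈ s, y α ∈ J := by
  classical
  induction s using Finset.induction_on generalizing y with
  | empty => simp
  | insert a s ha ih =>
    have key : ∀ b ∈ s, y b ∈ J := by
      intro b hb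
      have hab : R.weight b ≠ R.weight a := fun h =>
        ha (R.weight_injective h ▸ hb)
      obtain ⟨h, hh⟩ : ∃ h, R.weight b h ≠ R.weight a h := by
        by_contra! hc
        exact hab (LinearMap.ext hc)
      have h1 := ih (fun c => (R.weight c h - R.weight a h) • y c)
        (fun c hc => Submodule.smul_mem _ _ (hy c (Finset.mem_insert_of_mem hc))) ?_ b hb
      · exact (Submodule.smul_mem_iff _ (sub_ne_zero.2 hh)).1 h1
      · have h2 : ∑ c ∈ s, (R.weight c h - R.weight a h) • y c
            = ⁅D.H h, ∑ c ∈ insert a s, y c⁆ - R.weight a h • ∑ c ∈ insert a s, y c := by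
          rw [lie_sum, Finset.smul_sum, ← Finset.sum_sub_distrib, Finset.sum_insert ha,
            hy a (Finset.mem_insert_self _ _) h, sub_self, zero_add]
          refine Finset.sum_congr rfl fun c hc => ?_
          rw [hy c (Finset.mem_insert_of_mem hc) h, sub_smul]
        rw [h2]
        exact sub_mem (hJ _ _ hs) (J.smul_mem _ hs)
    intro b hb
    rcases Finset.mem_insert.1 hb with rfl | hb
    · rw [Finset.sum_insert ha] at hs
      exact (Submodule.add_mem_iff_left J (Submodule.sum_mem _ key)).1 hs
    · exact key b hb

theorem eq_of_mem_weightSpace {α β : I →₀ ℤ} {x : L} (hx : x ≠ 0) (hα : x ∈ D.weightSpace α)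
    (hβ : x ∈ D.weightSpace β) : α = β := by
  refine R.weight_injective (LinearMap.ext fun h => ?_)
  have := (hα h).symm.trans (hβ h)
  exact smul_left_injective ℂ hx this

/-- An element of the span of a set of weight vectors is a finite sum of weight vectors in the
spans of the elements of that set of the given weight. -/
theorem exists_sum_of_mem_span {G : Set L} (hG : ∀ g ∈ G, ∃ α, g ∈ D.weightSpace α) {x : L}
    (hx : x ∈ Submodule.span ℂ G) : ∃ (s : Finset (I →₀ ℤ)) (y : (I →₀ ℤ) → L),
      (∀ α, y α ∈ Submodule.span ℂ (G ∩ D.weightSpace α)) ∧ ∑ α ∈ s, y α = x := by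
  have h : Submodule.span ℂ G ≤ ⨆ α, Submodule.span ℂ (G ∩ D.weightSpace α) := by
    rw [Submodule.span_le]
    intro g hg
    obtain ⟨α, hα⟩ := hG g hg
    exact Submodule.mem_iSup_of_mem α (Submodule.subset_span ⟨hg, hα⟩)
  obtain ⟨y, hy, hyx⟩ := (Submodule.mem_iSup_iff_exists_finsupp _ _).1 (h hx)
  exact ⟨y.support, y, hy, hyx⟩

theorem span_inter_weightSpace_le (G : Set L) (α : I →₀ ℤ) :
    Submodule.span ℂ (G ∩ D.weightSpace α) ≤ D.weightSpace α :=
  Submodule.span_le.2 Set.inter_subset_right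

/-- If a nonzero vector of weight `α` lies in the span of a set of weight vectors, this set has a
nonzero element of weight `α`. -/
theorem exists_mem_weightSpace_of_mem_span {G : Set L}
    (hG : ∀ g ∈ G, ∃ α, g ∈ D.weightSpace α) {x : L} (hx : x ∈ Submodule.span ℂ G) (hx0 : x ≠ 0)
    {α : I →₀ ℤ} (hα : x ∈ D.weightSpace α) : ∃ g ∈ G, g ≠ 0 ∧ g ∈ D.weightSpace α := by
  classical
  by_contra! hc
  obtain ⟨s, y, hy, hyx⟩ := D.exists_sum_of_mem_span hG hx
  have hy' : ∀ β, y β ∈ D.weightSpace β := fun β => D.span_inter_weightSpace_le G β (hy β)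
  have hyα : y α = 0 := by
    have h1 : Submodule.span ℂ (G ∩ D.weightSpace α) = ⊥ := by
      rw [Submodule.span_eq_bot]
      rintro g ⟨hg, hgα⟩
      by_contra h0
      exact hc g hg h0 hgα
    simpa [h1] using hy α
  have key := D.mem_of_sum_mem (J := ⊥) (fun h x hx => by simp [(Submodule.mem_bot ℂ).1 hx])
    (insert α s) (fun β => y β - if β = α then x else 0) ?_ ?_ α (Finset.mem_insert_self _ _)
  · rw [Submodule.mem_bot] at key
    simp only [hyα, if_true, zero_sub, neg_eq_zero] at key
    exact hx0 key
  · intro β _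
    refine sub_mem (hy' β) ?_
    split_ifs with h
    · rwa [h]
    · exact zero_mem _
  · rw [Submodule.mem_bot, Finset.sum_sub_distrib]
    have h1 : ∑ β ∈ insert α s, y β = x := by
      rw [← hyx]
      by_cases hs : α ∈ s
      · rw [Finset.insert_eq_of_mem hs]
      · rw [Finset.sum_insert hs, hyα, zero_add]
    simp [h1]

end ChevalleyGenerators

end

end KacMoody

namespace KacMoody

noncomputable section

/-! ### Iterated brackets and the triangular decomposition -/

variable {I : Type*}

/-- The element `∑ α_i` of the root lattice, the sum being over the letters of a word. -/
def content (w : List I) : I →₀ ℤ := (w.map fun i => Finsupp.single i 1).sum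

@[simp] theorem content_nil : content ([] : List I) = 0 := rfl

@[simp] theorem content_cons (i : I) (w : List I) :
    content (i :: w) = Finsupp.single i 1 + content w := rfl

theorem content_nonneg (w : List I) : 0 ≤ content w := by
  induction w with
  | nil => exact le_rfl
  | cons i w ih => exact add_nonneg (Finsupp.single_nonneg.2 zero_le_one) ih

theorem content_apply_pos {w : List I} {i : I} : 0 < content w i ↔ i ∈ w := by
  classical
  induction w with
  | nil => simp
  | cons j w ih =>
    have h := content_nonneg w i
    rw [Finsupp.zero_apply] at h
    rw [content_cons, Finsupp.add_apply, Finsupp.single_apply, List.mem_cons, ← ih]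
    split_ifs with hij
    · simp only [hij, true_or, iff_true]
      subst hij
      omega
    · rw [zero_add, or_iff_right (Ne.symm hij)]

theorem content_cons_ne_zero (i : I) (w : List I) : content (i :: w) ≠ 0 := fun h => by
  have h1 : 0 < content (i :: w) i := content_apply_pos.2 (by simp)
  rw [h] at h1
  exact lt_irrefl _ h1

namespace ChevalleyGenerators

variable [Fintype I] {A : Matrix I I ℤ} {𝔥 : Type*} [AddCommGroup 𝔥] [Module ℂ 𝔥]
  {R : Realization A 𝔥} {L : Type*} [LieRing L] [LieAlgebra ℂ L] (D : ChevalleyGenerators R L)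

/-- The iterated bracket `[e_{i₁}, [e_{i₂}, …, [e_{iₙ}, x]]]`. -/
def wordLie (w : List I) (x : L) : L := w.foldr (fun i y => ⁅D.e i, y⁆) x

@[simp] theorem wordLie_nil (x : L) : D.wordLie [] x = x := rfl

@[simp] theorem wordLie_cons (i : I) (w : List I) (x : L) :
    D.wordLie (i :: w) x = ⁅D.e i, D.wordLie w x⁆ := rfl

theorem wordLie_mem_weightSpace (w : List I) {α : I →₀ ℤ} {x : L} (hx : x ∈ D.weightSpace α) :
    D.wordLie w x ∈ D.weightSpace (content w + α) := by
  induction w with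
  | nil => simpa using hx
  | cons i w ih =>
    rw [wordLie_cons, content_cons, add_assoc]
    exact D.lie_mem_weightSpace (D.e_mem_weightSpace i) ih

/-- The set of the iterated brackets of the `e_i`. -/
def posWords : Set L := {x | ∃ w i, x = D.wordLie w (D.e i)}

/-- The set of the iterated brackets of the `e_i` and of those of the `f_i`. -/
def rootWords : Set L := D.posWords ∪ D.swap.posWords

theorem rootWords_swap : D.swap.rootWords = D.rootWords := Set.union_comm _ _

theorem wordLie_e_mem_weightSpace (w : List I) (i : I) :
    D.wordLie w (D.e i) ∈ D.weightSpace (content (i :: w)) := by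
  rw [content_cons, add_comm]
  exact D.wordLie_mem_weightSpace w (D.e_mem_weightSpace i)

theorem exists_weight_of_mem_rootWords {g : L} (hg : g ∈ D.rootWords) :
    ∃ α ≠ 0, g ∈ D.weightSpace α := by
  rcases hg with ⟨w, i, rfl⟩ | ⟨w, i, rfl⟩
  · exact ⟨_, content_cons_ne_zero i w, D.wordLie_e_mem_weightSpace w i⟩
  · exact ⟨_, neg_ne_zero.2 (content_cons_ne_zero i w),
      (D.mem_weightSpace_swap).1 (D.swap.wordLie_e_mem_weightSpace w i)⟩

theorem H_lie_mem_span_posWords (x : 𝔥) {y : L} (hy : y ∈ Submodule.span ℂ D.posWords) :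
    ⁅D.H x, y⁆ ∈ Submodule.span ℂ D.posWords := by
  induction hy using Submodule.span_induction with
  | mem y hy =>
    obtain ⟨w, i, rfl⟩ := hy
    rw [D.wordLie_e_mem_weightSpace w i x]
    exact Submodule.smul_mem _ _ (Submodule.subset_span ⟨w, i, rfl⟩)
  | zero => simp
  | add a b _ _ ha hb => rw [lie_add]; exact add_mem ha hb
  | smul c a _ ha => rw [lie_smul]; exact Submodule.smul_mem _ c ha

theorem e_lie_mem_span_posWords (j : I) {y : L}
    (hy : y ∈ Submodule.span ℂ D.posWords ⊔ LinearMap.range D.H) :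
    ⁅D.e j, y⁆ ∈ Submodule.span ℂ D.posWords := by
  obtain ⟨a, ha, b, ⟨x, rfl⟩, rfl⟩ := Submodule.mem_sup.1 hy
  rw [lie_add]
  refine add_mem ?_ ?_
  · clear hy
    induction ha using Submodule.span_induction with
    | mem y hy =>
      obtain ⟨w, i, rfl⟩ := hy
      exact Submodule.subset_span ⟨j :: w, i, rfl⟩
    | zero => simp
    | add a b _ _ ha hb => rw [lie_add]; exact add_mem ha hb
    | smul c a _ ha => rw [lie_smul]; exact Submodule.smul_mem _ c ha
  · rw [← lie_skew, D.H_e]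
    exact neg_mem (Submodule.smul_mem _ _ (Submodule.subset_span ⟨[], j, rfl⟩))

theorem f_lie_e (i j : I) : ⁅D.f j, D.e i⁆ ∈ LinearMap.range D.H := by
  rw [← lie_skew]
  refine neg_mem ?_
  by_cases h : i = j
  · rw [h, D.e_f_same]
    exact ⟨_, rfl⟩
  · rw [D.e_f_ne i j h]
    exact zero_mem _

theorem f_lie_mem_span_posWords (j : I) {y : L} (hy : y ∈ Submodule.span ℂ D.posWords) :
    ⁅D.f j, y⁆ ∈ Submodule.span ℂ D.posWords ⊔ LinearMap.range D.H := by
  induction hy using Submodule.span_induction with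
  | mem y hy =>
    obtain ⟨w, i, rfl⟩ := hy
    induction w with
    | nil => exact Submodule.mem_sup_right (D.f_lie_e i j)
    | cons k w ih =>
      rw [wordLie_cons, leibniz_lie]
      obtain ⟨x, hx⟩ := D.f_lie_e k j
      rw [← hx]
      exact Submodule.mem_sup_left (add_mem
        (D.H_lie_mem_span_posWords x (Submodule.subset_span ⟨w, i, rfl⟩))
        (D.e_lie_mem_span_posWords k ih))
  | zero => simp
  | add a b _ _ ha hb => rw [lie_add]; exact add_mem ha hb
  | smul c a _ ha => rw [lie_smul]; exact Submodule.smul_mem _ c ha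

theorem range_swap_H : LinearMap.range D.swap.H = LinearMap.range D.H := LinearMap.range_neg _

theorem e_lie_mem_span_rootWords (i : I) {y : L}
    (hy : y ∈ Submodule.span ℂ D.rootWords ⊔ LinearMap.range D.H) :
    ⁅D.e i, y⁆ ∈ Submodule.span ℂ D.rootWords ⊔ LinearMap.range D.H := by
  rw [rootWords, Submodule.span_union] at hy ⊢
  obtain ⟨a, ha, b, hb, rfl⟩ := Submodule.mem_sup.1 hy
  obtain ⟨a₁, ha₁, a₂, ha₂, rfl⟩ := Submodule.mem_sup.1 ha
  rw [add_right_comm, lie_add]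
  refine add_mem ?_ ?_
  · exact Submodule.mem_sup_left (Submodule.mem_sup_left (D.e_lie_mem_span_posWords i
      (add_mem (Submodule.mem_sup_left ha₁) (Submodule.mem_sup_right hb))))
  · have := D.swap.f_lie_mem_span_posWords i ha₂
    rw [range_swap_H] at this
    exact SetLike.le_def.1 (sup_le_sup_right le_sup_right _) this

/-- The Lie algebra `L` is spanned by the iterated brackets of the `e_i`, those of the `f_i`, and
the elements `H(x)`. -/
theorem span_rootWords_sup_range_H :
    Submodule.span ℂ D.rootWords ⊔ LinearMap.range D.H = ⊤ := by
  apply D.eq_top_of_forall_generator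
  · exact fun i => Submodule.mem_sup_left (Submodule.subset_span (Or.inl ⟨[], i, rfl⟩))
  · exact fun i => Submodule.mem_sup_left (Submodule.subset_span (Or.inr ⟨[], i, rfl⟩))
  · exact fun x => Submodule.mem_sup_right ⟨x, rfl⟩
  · exact fun i y hy => D.e_lie_mem_span_rootWords i hy
  · intro i y hy
    rw [← rootWords_swap, ← range_swap_H] at hy ⊢
    exact D.swap.e_lie_mem_span_rootWords i hy
  · intro x y hy
    obtain ⟨a, ha, b, ⟨z, rfl⟩, rfl⟩ := Submodule.mem_sup.1 hy
    rw [lie_add, D.H_H, add_zero]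
    rw [rootWords, Submodule.span_union] at ha
    obtain ⟨a₁, ha₁, a₂, ha₂, rfl⟩ := Submodule.mem_sup.1 ha
    rw [lie_add, rootWords, Submodule.span_union]
    refine Submodule.mem_sup_left (add_mem (Submodule.mem_sup_left
      (D.H_lie_mem_span_posWords x ha₁)) (Submodule.mem_sup_right ?_))
    simpa using D.swap.H_lie_mem_span_posWords (-x) ha₂

theorem span_rootWords_union_range_H :
    Submodule.span ℂ (D.rootWords ∪ Set.range D.H) = ⊤ := by
  rw [Submodule.span_union, ← D.span_rootWords_sup_range_H, ← LinearMap.coe_range,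
    Submodule.span_eq]

theorem exists_weight_of_mem_rootWords_union {g : L} (hg : g ∈ D.rootWords ∪ Set.range D.H) :
    ∃ α, g ∈ D.weightSpace α := by
  rcases hg with hg | ⟨y, rfl⟩
  · exact (D.exists_weight_of_mem_rootWords hg).imp fun _ h => h.2
  · exact ⟨0, D.H_mem_weightSpace y⟩

/-- A weight vector of nonzero weight that is itself nonzero forces an iterated bracket of the
same weight to be nonzero. -/
theorem exists_rootWords {α : I →₀ ℤ} (hα : α ≠ 0) {x : L} (hx : x ≠ 0)
    (hxα : x ∈ D.weightSpace α) : ∃ g ∈ D.rootWords, g ≠ 0 ∧ g ∈ D.weightSpace α := by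
  obtain ⟨g, hg, hg0, hgα⟩ := D.exists_mem_weightSpace_of_mem_span
    (fun g hg => D.exists_weight_of_mem_rootWords_union hg)
    (D.span_rootWords_union_range_H ▸ Submodule.mem_top) hx hxα
  rcases hg with hg | ⟨y, rfl⟩
  · exact ⟨g, hg, hg0, hgα⟩
  · exact absurd (D.eq_of_mem_weightSpace hg0 hgα (D.H_mem_weightSpace y)) hα

theorem H_eq_zero_of_mem_span_rootWords {x : 𝔥} (hx : D.H x ∈ Submodule.span ℂ D.rootWords) :
    D.H x = 0 := by
  by_contra h0
  obtain ⟨g, hg, hg0, hg'⟩ := D.exists_mem_weightSpace_of_mem_span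
    (fun g hg => (D.exists_weight_of_mem_rootWords hg).imp fun _ h => h.2) hx h0
    (D.H_mem_weightSpace x)
  obtain ⟨α, hα, hgα⟩ := D.exists_weight_of_mem_rootWords hg
  exact hα (D.eq_of_mem_weightSpace hg0 hgα hg')

/-- Since ideals are graded by the root lattice, an ideal that meets the image of `𝔥` trivially
has no component of weight zero. -/
theorem ideal_le_span_rootWords {J : LieIdeal ℂ L} (hJ : ∀ x, D.H x ∈ J → D.H x = 0) :
    J.toSubmodule ≤ Submodule.span ℂ D.rootWords := by
  intro x hx
  obtain ⟨s, y, hy, rfl⟩ := D.exists_sum_of_mem_span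
    (fun g hg => D.exists_weight_of_mem_rootWords_union hg)
    (D.span_rootWords_union_range_H ▸ Submodule.mem_top : x ∈ _)
  have hyJ := D.mem_of_sum_mem (J := J.toSubmodule) (fun h x hx => lie_mem_right ℂ L J _ _ hx) s y
    (fun α _ => D.span_inter_weightSpace_le _ α (hy α)) hx
  refine Submodule.sum_mem _ fun α hα => ?_
  by_cases hα0 : α = 0
  · have h1 : y α ∈ LinearMap.range D.H := by
      refine (Submodule.span_le.2 ?_ : _ ≤ LinearMap.range D.H) (hy α)
      rintro g ⟨hg | hg, hgα⟩
      · obtain ⟨β, hβ, hgβ⟩ := D.exists_weight_of_mem_rootWords hg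
        by_cases hg0 : g = 0
        · rw [hg0]; exact zero_mem _
        · exact absurd ((D.eq_of_mem_weightSpace hg0 hgβ hgα).trans hα0) hβ
      · exact hg
    obtain ⟨z, hz⟩ := h1
    have h2 := hyJ α hα
    rw [← hz] at h2 ⊢
    rw [hJ z h2]
    exact zero_mem _
  · refine (Submodule.span_le.2 ?_ : _ ≤ Submodule.span ℂ D.rootWords) (hy α)
    rintro g ⟨hg | ⟨z, rfl⟩, hgα⟩
    · exact Submodule.subset_span hg
    · by_cases hg0 : D.H z = 0
      · rw [hg0]; exact zero_mem _
      · exact absurd (D.eq_of_mem_weightSpace hg0 hgα (D.H_mem_weightSpace z)) hα0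

end ChevalleyGenerators

end

end KacMoody

namespace KacMoody

noncomputable section

/-! ### A highest weight module of the auxiliary algebra -/

attribute [local instance] LieRing.ofAssociativeRing LieAlgebra.ofAssociativeAlgebra

variable {I : Type*}

/-- The action of `f_i` on the module with basis the words in `I`. -/
def moduleF (i : I) : Module.End ℂ (List I →₀ ℂ) := Finsupp.lmapDomain ℂ ℂ (List.cons i)

@[simp] theorem moduleF_single (i : I) (w : List I) :
    moduleF i (Finsupp.single w 1) = Finsupp.single (i :: w) (1 : ℂ) := by
  simp [moduleF]

theorem end_ext {φ ψ : Module.End ℂ (List I →₀ ℂ)}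
    (h : ∀ w, φ (Finsupp.single w 1) = ψ (Finsupp.single w 1)) : φ = ψ :=
  Finsupp.lhom_ext' fun w => LinearMap.ext_ring (h w)

theorem end_lie_apply {V : Type*} [AddCommGroup V] [Module ℂ V] (φ ψ : Module.End ℂ V) (v : V) :
    ⁅φ, ψ⁆ v = φ (ψ v) - ψ (φ v) := rfl

variable [Fintype I] {A : Matrix I I ℤ} {𝔥 : Type*} [AddCommGroup 𝔥] [Module ℂ 𝔥]

namespace Realization

variable (R : Realization A 𝔥) (l : Module.Dual ℂ 𝔥)

/-- The weight `λ - α_{i₁} - … - α_{iₙ}` of the vector `f_{i₁} ⋯ f_{iₙ} v` in the highest weight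
module with highest weight vector `v` of weight `λ`. -/
def wordWeight : List I → Module.Dual ℂ 𝔥
  | [] => l
  | i :: w => wordWeight w - R.root i

/-- The action of `x ∈ 𝔥` on the module with basis the words in `I`. -/
def moduleH (x : 𝔥) : Module.End ℂ (List I →₀ ℂ) :=
  Finsupp.linearCombination ℂ fun w => R.wordWeight l w x • Finsupp.single w 1

open Classical in
/-- The action of `e_i` on a word: the value that the relations and `e_i v = 0` force on
`f_{i₁} ⋯ f_{iₙ} v`. -/
def moduleEWord (i : I) : List I → (List I →₀ ℂ)
  | [] => 0
  | j :: w => moduleF j (moduleEWord i w) +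
      if i = j then moduleH R l (R.coroot i) (Finsupp.single w 1) else 0

/-- The action of `e_i` on the module with basis the words in `I`. -/
def moduleE (i : I) : Module.End ℂ (List I →₀ ℂ) :=
  Finsupp.linearCombination ℂ (R.moduleEWord l i)

@[simp] theorem moduleH_single (x : 𝔥) (w : List I) :
    R.moduleH l x (Finsupp.single w 1) = R.wordWeight l w x • Finsupp.single w 1 := by
  rw [moduleH, Finsupp.linearCombination_single, one_smul]

@[simp] theorem moduleE_single (i : I) (w : List I) :
    R.moduleE l i (Finsupp.single w 1) = R.moduleEWord l i w := by
  rw [moduleE, Finsupp.linearCombination_single, one_smul]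

theorem moduleH_moduleF (x : 𝔥) (i : I) :
    ⁅R.moduleH l x, moduleF i⁆ = -(R.root i x • moduleF i) := by
  refine end_ext fun w => ?_
  rw [end_lie_apply,
    LinearMap.neg_apply, LinearMap.smul_apply, moduleF_single, moduleH_single, moduleH_single,
    map_smul, moduleF_single, ← sub_smul, ← neg_smul, wordWeight, LinearMap.sub_apply]
  congr 1
  ring

theorem moduleH_moduleF_apply (x : 𝔥) (i : I) (v : List I →₀ ℂ) :
    R.moduleH l x (moduleF i v) = moduleF i (R.moduleH l x v) - R.root i x • moduleF i v := by
  have h := LinearMap.congr_fun (R.moduleH_moduleF l x i) v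
  rw [end_lie_apply,
    LinearMap.neg_apply, LinearMap.smul_apply] at h
  rw [sub_eq_iff_eq_add'.1 h, sub_eq_add_neg]

theorem moduleH_moduleEWord (x : 𝔥) (i : I) (w : List I) :
    R.moduleH l x (R.moduleEWord l i w) =
      (R.wordWeight l w x + R.root i x) • R.moduleEWord l i w := by
  induction w with
  | nil => simp [moduleEWord]
  | cons j w ih =>
    rw [moduleEWord, map_add, moduleH_moduleF_apply, ih, map_smul, smul_add, ← sub_smul,
      wordWeight, LinearMap.sub_apply]
    congr 1
    · congr 1
      ring
    · split_ifs with h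
      · subst h
        rw [moduleH_single, map_smul, moduleH_single, sub_add_cancel, smul_comm]
      · simp

/-- The action of the generators on the module with basis the words in `I`. -/
def moduleAction : Generator I 𝔥 → Module.End ℂ (List I →₀ ℂ)
  | .e i => R.moduleE l i
  | .f i => moduleF i
  | .h x => R.moduleH l x

theorem moduleH_add (x y : 𝔥) : R.moduleH l (x + y) = R.moduleH l x + R.moduleH l y :=
  end_ext fun w => by simp [add_smul]

theorem moduleH_smul (c : ℂ) (x : 𝔥) : R.moduleH l (c • x) = c • R.moduleH l x :=
  end_ext fun w => by simp [mul_smul]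

theorem lift_moduleAction_eq {a b : FreeLieAlgebra ℂ (Generator I 𝔥)} (hab : R.Rel a b) :
    FreeLieAlgebra.lift ℂ (R.moduleAction l) a = FreeLieAlgebra.lift ℂ (R.moduleAction l) b := by
  cases hab with
  | h_add x y => simp [freeH, moduleAction, moduleH_add]
  | h_smul c x => simp [freeH, moduleAction, moduleH_smul]
  | e_f_same i =>
    simp only [freeE, freeF, freeH, LieHom.map_lie, FreeLieAlgebra.lift_of_apply, moduleAction]
    refine end_ext fun w => ?_
    rw [end_lie_apply,
      moduleF_single, moduleE_single, moduleE_single, moduleEWord, if_pos rfl, add_sub_cancel_left]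
  | e_f_ne i j hij =>
    simp only [freeE, freeF, LieHom.map_lie, FreeLieAlgebra.lift_of_apply, moduleAction, map_zero]
    refine end_ext fun w => ?_
    rw [end_lie_apply,
      moduleF_single, moduleE_single, moduleE_single, moduleEWord, if_neg hij, add_sub_cancel_left,
      LinearMap.zero_apply]
  | h_h x y =>
    simp only [freeH, LieHom.map_lie, FreeLieAlgebra.lift_of_apply, moduleAction, map_zero]
    refine end_ext fun w => ?_
    rw [end_lie_apply,
      moduleH_single, moduleH_single, map_smul, map_smul, moduleH_single, moduleH_single,
      smul_comm, sub_self, LinearMap.zero_apply]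
  | h_e x i =>
    simp only [freeH, freeE, LieHom.map_lie, map_smul, FreeLieAlgebra.lift_of_apply,
      moduleAction]
    refine end_ext fun w => ?_
    rw [end_lie_apply,
      moduleE_single, moduleH_single, map_smul, moduleE_single, moduleH_moduleEWord,
      LinearMap.smul_apply, moduleE_single, ← sub_smul, add_sub_cancel_left]
  | h_f x i =>
    simp only [freeH, freeF, LieHom.map_lie, map_smul, map_neg,
      FreeLieAlgebra.lift_of_apply, moduleAction]
    exact R.moduleH_moduleF l x i

theorem relIdeal_le_ker_lift : R.relIdeal ≤ (FreeLieAlgebra.lift ℂ (R.moduleAction l)).ker := by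
  rw [relIdeal, LieSubmodule.lieSpan_le]
  rintro _ ⟨a, b, hab, rfl⟩
  rw [SetLike.mem_coe, LieHom.mem_ker, map_sub, R.lift_moduleAction_eq l hab, sub_self]

/-- `𝔥` embeds into `𝔤̃(A)`: an element `x ∈ 𝔥` acts on the vector of highest weight `λ` by
`λ(x)`. -/
theorem auxCartan_eq_zero_iff {x : 𝔥} : R.auxCartan x = 0 ↔ x = 0 := by
  have key : R.auxCartan x = 0 ↔ freeH I x ∈ R.relIdeal :=
    LieSubmodule.Quotient.mk_eq_zero' (N := R.relIdeal)
  rw [key]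
  constructor
  · intro h
    rw [← Module.forall_dual_apply_eq_zero_iff ℂ]
    intro l
    have h1 := R.relIdeal_le_ker_lift l h
    rw [LieHom.mem_ker, FreeLieAlgebra.lift_of_apply] at h1
    have h2 := LinearMap.congr_fun h1 (Finsupp.single [] 1)
    rw [moduleAction, moduleH_single, LinearMap.zero_apply] at h2
    simpa [wordWeight] using h2
  · rintro rfl
    have h : freeH I (0 : 𝔥) = freeH I ((0 : ℂ) • (0 : 𝔥)) - (0 : ℂ) • freeH I (0 : 𝔥) := by
      simp
    rw [h]
    exact LieSubmodule.subset_lieSpan ⟨_, _, Rel.h_smul 0 0, rfl⟩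

/-! ### The Kac–Moody algebra -/

theorem mk_eq_mk_of_rel {a b : FreeLieAlgebra ℂ (Generator I 𝔥)} (hab : R.Rel a b) :
    (LieSubmodule.Quotient.mk (N := R.relIdeal) a : FreeLieAlgebra ℂ (Generator I 𝔥) ⧸ R.relIdeal)
      = LieSubmodule.Quotient.mk (N := R.relIdeal) b :=
  (Submodule.Quotient.eq _).2 (LieSubmodule.subset_lieSpan ⟨a, b, hab, rfl⟩)

end Realization

theorem lieSpan_range_of (X : Type*) :
    LieSubalgebra.lieSpan ℂ _ (Set.range (FreeLieAlgebra.of ℂ : X → FreeLieAlgebra ℂ X)) = ⊤ := by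
  set K := LieSubalgebra.lieSpan ℂ _ (Set.range (FreeLieAlgebra.of ℂ : X → FreeLieAlgebra ℂ X))
  let φ : FreeLieAlgebra ℂ X →ₗ⁅ℂ⁆ K := FreeLieAlgebra.lift ℂ fun x =>
    ⟨FreeLieAlgebra.of ℂ x, LieSubalgebra.subset_lieSpan ⟨x, rfl⟩⟩
  have h : K.incl.comp φ = LieHom.id := FreeLieAlgebra.hom_ext fun x => by simp [φ]
  rw [eq_top_iff]
  intro x _
  have hx := LieHom.congr_fun h x
  have hx' : ((φ x : K) : FreeLieAlgebra ℂ X) = x := hx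
  rw [← hx']
  exact (φ x).2

/-- The quotient map by an ideal, as a homomorphism of Lie algebras. -/
def quotientHom {L : Type*} [LieRing L] [LieAlgebra ℂ L] (J : LieIdeal ℂ L) : L →ₗ⁅ℂ⁆ L ⧸ J :=
  { (LieSubmodule.Quotient.mk' J : L →ₗ[ℂ] L ⧸ J) with
    map_lie' := fun {x y} => LieSubmodule.Quotient.mk_bracket (I := J) x y }

theorem quotientHom_surjective {L : Type*} [LieRing L] [LieAlgebra ℂ L] (J : LieIdeal ℂ L) :
    Function.Surjective (quotientHom J) := LieSubmodule.Quotient.surjective_mk' J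

/-- The Chevalley generators of `𝔤̃(A)`. -/
def Realization.auxGenerators (R : Realization A 𝔥) : ChevalleyGenerators R R.AuxAlgebra where
  e i := LieSubmodule.Quotient.mk (N := R.relIdeal) (freeE 𝔥 i)
  f i := LieSubmodule.Quotient.mk (N := R.relIdeal) (freeF 𝔥 i)
  H :=
    { toFun := R.auxCartan
      map_add' := fun x y => R.mk_eq_mk_of_rel (.h_add x y)
      map_smul' := fun c x => R.mk_eq_mk_of_rel (.h_smul c x) }
  e_f_same i := R.mk_eq_mk_of_rel (.e_f_same i)
  e_f_ne i j hij := R.mk_eq_mk_of_rel (.e_f_ne i j hij)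
  H_H x y := R.mk_eq_mk_of_rel (.h_h x y)
  H_e x i := R.mk_eq_mk_of_rel (.h_e x i)
  H_f x i := R.mk_eq_mk_of_rel (.h_f x i)
  lieSpan_eq_top := by
    have h := congrArg (LieSubalgebra.map (quotientHom R.relIdeal))
      (lieSpan_range_of (Generator I 𝔥))
    rw [LieSubalgebra.map_lieSpan] at h
    rw [eq_top_iff]
    intro y _
    obtain ⟨x, rfl⟩ := quotientHom_surjective R.relIdeal y
    have hx : quotientHom R.relIdeal x ∈ LieSubalgebra.map (quotientHom R.relIdeal) ⊤ :=
      ⟨x, trivial, rfl⟩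
    rw [← h] at hx
    refine LieSubalgebra.lieSpan_mono ?_ hx
    rintro _ ⟨_, ⟨i | i | x, rfl⟩, rfl⟩
    exacts [Or.inl (Or.inl ⟨i, rfl⟩), Or.inl (Or.inr ⟨i, rfl⟩), Or.inr ⟨x, rfl⟩]

/-- The images of Chevalley generators under a surjective homomorphism. -/
def ChevalleyGenerators.map {R : Realization A 𝔥} {L L' : Type*} [LieRing L] [LieAlgebra ℂ L]
    [LieRing L'] [LieAlgebra ℂ L'] (D : ChevalleyGenerators R L) (φ : L →ₗ⁅ℂ⁆ L')
    (hφ : Function.Surjective φ) : ChevalleyGenerators R L' where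
  e i := φ (D.e i)
  f i := φ (D.f i)
  H := (φ : L →ₗ[ℂ] L').comp D.H
  e_f_same i := by rw [← LieHom.map_lie, D.e_f_same]; rfl
  e_f_ne i j hij := by rw [← LieHom.map_lie, D.e_f_ne i j hij, map_zero]
  H_H x y := by
    have h := congrArg φ (D.H_H x y)
    rwa [LieHom.map_lie, map_zero] at h
  H_e x i := by
    have h := congrArg φ (D.H_e x i)
    rwa [LieHom.map_lie, map_smul] at h
  H_f x i := by
    have h := congrArg φ (D.H_f x i)
    rwa [LieHom.map_lie, map_neg, map_smul] at h
  lieSpan_eq_top := by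
    have h := congrArg (LieSubalgebra.map φ) D.lieSpan_eq_top
    rw [LieSubalgebra.map_lieSpan] at h
    rw [eq_top_iff]
    intro y _
    obtain ⟨x, rfl⟩ := hφ y
    have hx : φ x ∈ LieSubalgebra.map φ ⊤ := ⟨x, trivial, rfl⟩
    rw [← h] at hx
    refine LieSubalgebra.lieSpan_mono ?_ hx
    rintro _ ⟨_, (⟨i, rfl⟩ | ⟨i, rfl⟩) | ⟨x, rfl⟩, rfl⟩
    exacts [Or.inl (Or.inl ⟨i, rfl⟩), Or.inl (Or.inr ⟨i, rfl⟩), Or.inr ⟨x, rfl⟩]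

namespace ChevalleyGenerators

variable {R : Realization A 𝔥} {L : Type*} [LieRing L] [LieAlgebra ℂ L]
  (D : ChevalleyGenerators R L)

/-- The properties that characterize `𝔤(A)` among the Lie algebras with Chevalley generators: `𝔥`
embeds, and no nonzero ideal meets it trivially. -/
structure IsKacMoody : Prop where
  H_eq_zero : ∀ x, D.H x = 0 → x = 0
  ideal_eq_bot : ∀ J : LieIdeal ℂ L, (∀ x, D.H x ∈ J → D.H x = 0) → J = ⊥

variable {D}

theorem IsKacMoody.swap (hD : D.IsKacMoody) : D.swap.IsKacMoody where
  H_eq_zero x hx := hD.H_eq_zero x (neg_eq_zero.1 hx)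
  ideal_eq_bot J hJ := hD.ideal_eq_bot J fun x hx =>
    neg_eq_zero.1 (hJ x ((neg_mem_iff (x := D.H x)).2 hx))

end ChevalleyGenerators

namespace Realization

variable (R : Realization A 𝔥)

/-- The sum of the ideals that meet `𝔥` trivially meets `𝔥` trivially, since all of them lie in the
span of the root vectors. -/
theorem auxCartan_eq_zero_of_mem_radical {x : 𝔥} (hx : R.auxCartan x ∈ R.radical) :
    R.auxCartan x = 0 := by
  refine R.auxGenerators.H_eq_zero_of_mem_span_rootWords ?_
  have h : R.radical.toSubmodule ≤ Submodule.span ℂ R.auxGenerators.rootWords := by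
    rw [radical, LieSubmodule.sSup_toSubmodule, sSup_le_iff]
    rintro _ ⟨J, hJ, rfl⟩
    exact R.auxGenerators.ideal_le_span_rootWords hJ
  exact h hx

/-- The Chevalley generators of `𝔤(A)`. -/
def generators : ChevalleyGenerators R R.KMAlgebra :=
  R.auxGenerators.map (quotientHom R.radical) (quotientHom_surjective R.radical)

theorem cartan_eq_zero_iff_mem {x : 𝔥} : R.cartan x = 0 ↔ R.auxCartan x ∈ R.radical :=
  LieSubmodule.Quotient.mk_eq_zero' (N := R.radical)

theorem isKacMoody_generators : R.generators.IsKacMoody where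
  H_eq_zero x hx := R.auxCartan_eq_zero_iff.1
    (R.auxCartan_eq_zero_of_mem_radical (R.cartan_eq_zero_iff_mem.1 hx))
  ideal_eq_bot J hJ := by
    let q : R.AuxAlgebra →ₗ⁅ℂ⁆ R.KMAlgebra := quotientHom R.radical
    have hle : J.comap q ≤ R.radical := by
      refine le_sSup (a := J.comap q) fun x hx => ?_
      have h1 : R.cartan x = 0 := hJ x (LieIdeal.mem_comap.1 hx)
      exact R.auxCartan_eq_zero_of_mem_radical (R.cartan_eq_zero_iff_mem.1 h1)
    rw [eq_bot_iff]
    intro y hy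
    obtain ⟨x, rfl⟩ := quotientHom_surjective R.radical y
    exact (LieSubmodule.mem_bot _).2 <| (LieSubmodule.Quotient.mk_eq_zero' (N := R.radical)).2
      (hle (LieIdeal.mem_comap.2 hy))

end Realization

end

end KacMoody

namespace KacMoody

noncomputable section

variable {I : Type*}

/-! ### The action of the simple `𝔰𝔩₂`-triples -/

/-- `A` is a generalized Cartan matrix. -/
structure IsCartanMatrix (A : Matrix I I ℤ) : Prop where
  diag : ∀ i, A i i = 2
  nonpos : ∀ i j, i ≠ j → A i j ≤ 0
  eq_zero : ∀ i j, A i j = 0 → A j i = 0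

section Pairing

variable [Fintype I] (A : Matrix I I ℤ)

theorem pairing_add (α β : I →₀ ℤ) (i : I) :
    pairing A (α + β) i = pairing A α i + pairing A β i := by
  simp [pairing, add_mul, Finset.sum_add_distrib]

theorem pairing_smul (n : ℤ) (α : I →₀ ℤ) (i : I) :
    pairing A (n • α) i = n * pairing A α i := by
  simp [pairing, Finset.mul_sum, mul_assoc]

theorem pairing_neg (α : I →₀ ℤ) (i : I) : pairing A (-α) i = -pairing A α i := by
  simp [pairing]

theorem pairing_sub (α β : I →₀ ℤ) (i : I) :
    pairing A (α - β) i = pairing A α i - pairing A β i := by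
  rw [sub_eq_add_neg, pairing_add, pairing_neg, sub_eq_add_neg]

theorem pairing_single (j i : I) : pairing A (Finsupp.single j 1) i = A i j := by
  classical
  simp [pairing, Finsupp.single_apply]

end Pairing

namespace ChevalleyGenerators

variable [Fintype I] {A : Matrix I I ℤ} {𝔥 : Type*} [AddCommGroup 𝔥] [Module ℂ 𝔥]
  {R : Realization A 𝔥} {L : Type*} [LieRing L] [LieAlgebra ℂ L] (D : ChevalleyGenerators R L)

open LieAlgebra (ad)

theorem ad_pow_succ_apply (x y : L) (n : ℕ) : (ad ℂ L x ^ (n + 1)) y = ⁅x, (ad ℂ L x ^ n) y⁆ := by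
  rw [pow_succ', Module.End.mul_apply, LieAlgebra.ad_apply]

theorem ad_pow_succ_apply' (x y : L) (n : ℕ) : (ad ℂ L x ^ (n + 1)) y = (ad ℂ L x ^ n) ⁅x, y⁆ := by
  rw [pow_succ, Module.End.mul_apply, LieAlgebra.ad_apply]

theorem lie_ad_pow_of_lie_eq_zero {a b : L} (h : ⁅a, b⁆ = 0) (n : ℕ) (y : L) :
    ⁅a, (ad ℂ L b ^ n) y⁆ = (ad ℂ L b ^ n) ⁅a, y⁆ := by
  induction n with
  | zero => rfl
  | succ n ih => rw [ad_pow_succ_apply, leibniz_lie, h, zero_lie, zero_add, ih, ad_pow_succ_apply]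

theorem f_pow_mem_weightSpace (i : I) (n : ℕ) {α : I →₀ ℤ} {x : L} (hx : x ∈ D.weightSpace α) :
    (ad ℂ L (D.f i) ^ n) x ∈ D.weightSpace (α - (n : ℤ) • Finsupp.single i 1) := by
  induction n with
  | zero => simpa using hx
  | succ n ih =>
    rw [ad_pow_succ_apply]
    have h := D.lie_f_mem_weightSpace i ih
    have h1 : α - ((n + 1 : ℕ) : ℤ) • Finsupp.single i 1 =
        α - (n : ℤ) • Finsupp.single i 1 - Finsupp.single i 1 := by
      push_cast
      rw [add_smul, one_smul, sub_sub]
    rwa [h1]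

/-- The commutator of `e` with a power of `f` in a representation of `𝔰𝔩₂`. -/
theorem e_lie_f_pow (hA : A i i = 2) (k : ℕ) {α : I →₀ ℤ} {x : L} (hx : x ∈ D.weightSpace α) :
    ⁅D.e i, (ad ℂ L (D.f i) ^ (k + 1)) x⁆ = (ad ℂ L (D.f i) ^ (k + 1)) ⁅D.e i, x⁆ +
      (((k + 1) * (pairing A α i - k) : ℤ) : ℂ) • (ad ℂ L (D.f i) ^ k) x := by
  induction k with
  | zero =>
    simp only [zero_add, pow_one, LieAlgebra.ad_apply, pow_zero, Module.End.one_apply]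
    rw [leibniz_lie, D.e_f_same, hx, R.weight_coroot, add_comm]
    simp
  | succ k ih =>
    rw [ad_pow_succ_apply, leibniz_lie, D.e_f_same, D.f_pow_mem_weightSpace i (k + 1) hx,
      R.weight_coroot, ih, lie_add, lie_smul, ← ad_pow_succ_apply, ← ad_pow_succ_apply,
      add_left_comm, ← add_smul, pairing_sub, pairing_smul, pairing_single, hA]
    congr 2
    push_cast
    ring

/-- In a module of `𝔰𝔩₂`, a vector of weight `m ≥ 0` killed by a power of `e` is not killed by the
`m`-th power of `f`. -/
theorem eq_zero_of_f_pow_eq_zero (hA : A i i = 2) {n k : ℕ} {α : I →₀ ℤ} {x : L}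
    (hx : x ∈ D.weightSpace α) (hn : (ad ℂ L (D.e i) ^ n) x = 0)
    (hk : (ad ℂ L (D.f i) ^ k) x = 0) (hkm : (k : ℤ) ≤ pairing A α i) : x = 0 := by
  induction n generalizing k α x with
  | zero => simpa using hn
  | succ n ih =>
    -- It suffices to see that `[e, x] = 0`: then `e f^k x` is a nonzero multiple of `f^(k-1) x`.
    cases k with
    | zero => simpa using hk
    | succ k =>
      have hex : ⁅D.e i, x⁆ = 0 := by
        refine ih (k := k + 2) (D.lie_e_mem_weightSpace i hx) (by rwa [← ad_pow_succ_apply']) ?_ ?_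
        · have h := D.e_lie_f_pow hA (k + 1) hx
          rwa [ad_pow_succ_apply, hk, lie_zero, lie_zero, smul_zero, add_zero, eq_comm] at h
        · rw [pairing_add, pairing_single, hA]
          push_cast at hkm ⊢
          omega
      clear hn
      induction k with
      | zero =>
        have h := D.e_lie_f_pow hA 0 hx
        rw [hk, hex, lie_zero, map_zero, zero_add] at h
        have hne : (((0 : ℕ) + 1) * (pairing A α i - (0 : ℕ)) : ℤ) ≠ 0 := by
          push_cast at hkm ⊢
          omega
        simpa using (smul_eq_zero.1 h.symm).resolve_left (Int.cast_ne_zero.2 hne)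
      | succ k ihk =>
        have h := D.e_lie_f_pow hA (k + 1) hx
        rw [hk, hex, lie_zero, map_zero, zero_add] at h
        have hne : (((k + 1 : ℕ) : ℤ) + 1) * (pairing A α i - (k + 1 : ℕ)) ≠ 0 := by
          push_cast at hkm ⊢
          exact mul_ne_zero (by omega) (by omega)
        exact ihk ((smul_eq_zero.1 h.symm).resolve_left (Int.cast_ne_zero.2 hne))
          (by push_cast at hkm ⊢; omega)

/-! ### Integrability -/

variable {D}

/-- A vector of positive weight killed by all `f_i` generates an ideal that meets `𝔥` trivially. -/
theorem IsKacMoody.eq_zero_of_forall_lie_f (hD : D.IsKacMoody) {α : I →₀ ℤ} (hα : 0 ≤ α)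
    (hα0 : α ≠ 0) {x : L} (hx : x ∈ D.weightSpace α) (hf : ∀ i, ⁅D.f i, x⁆ = 0) : x = 0 := by
  let T : Submodule ℂ L := Submodule.span ℂ (Set.range fun w => D.wordLie w x)
  have hT : ∀ w, D.wordLie w x ∈ T := fun w => Submodule.subset_span ⟨w, rfl⟩
  have hspan : ∀ z : L, (∀ w, ⁅z, D.wordLie w x⁆ ∈ T) → ∀ y ∈ T, ⁅z, y⁆ ∈ T := by
    intro z hz y hy
    induction hy using Submodule.span_induction with
    | mem y hy => obtain ⟨w, rfl⟩ := hy; exact hz w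
    | zero => simp
    | add a b _ _ ha hb => rw [lie_add]; exact add_mem ha hb
    | smul c a _ ha => rw [lie_smul]; exact Submodule.smul_mem _ c ha
  have he' : ∀ i, ∀ y ∈ T, ⁅D.e i, y⁆ ∈ T := fun i => hspan _ fun w => hT (i :: w)
  have hH' : ∀ h, ∀ y ∈ T, ⁅D.H h, y⁆ ∈ T := fun h => hspan _ fun w => by
    rw [D.wordLie_mem_weightSpace w hx h]
    exact Submodule.smul_mem _ _ (hT w)
  have hf' : ∀ i, ∀ y ∈ T, ⁅D.f i, y⁆ ∈ T := fun i => hspan _ fun w => by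
    induction w with
    | nil => rw [wordLie_nil, hf]; exact zero_mem _
    | cons k w ih =>
      obtain ⟨h, hh⟩ := D.f_lie_e k i
      rw [wordLie_cons, leibniz_lie, ← hh]
      exact add_mem (hH' _ _ (hT w)) (he' _ _ ih)
  let J : LieIdeal ℂ L :=
    { T with lie_mem := fun {z y} hy => D.lie_mem_of_forall_generator he' hf' hH' z y hy }
  have hweight : ∀ w, content w + α ≠ 0 := fun w h =>
    hα0 (le_antisymm ((le_add_of_nonneg_left (content_nonneg w)).trans h.le) hα)
  have hJ : J = ⊥ := by
    refine hD.ideal_eq_bot J fun z hz => ?_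
    by_contra h0
    obtain ⟨_, ⟨w, rfl⟩, hg0, hg⟩ := D.exists_mem_weightSpace_of_mem_span
      (by rintro _ ⟨w, rfl⟩; exact ⟨_, D.wordLie_mem_weightSpace w hx⟩) hz h0
      (D.H_mem_weightSpace z)
    exact hweight w (D.eq_of_mem_weightSpace hg0 (D.wordLie_mem_weightSpace w hx) hg)
  have hxJ : x ∈ J := hT []
  rwa [hJ, LieSubmodule.mem_bot] at hxJ

/-- The Serre relations: the left-hand side has positive weight and commutes with all `f_k`. -/
theorem IsKacMoody.serre (hD : D.IsKacMoody) (hA : IsCartanMatrix A) {i j : I} (hij : i ≠ j) :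
    (ad ℂ L (D.e i) ^ ((-A i j).toNat + 1)) (D.e j) = 0 := by
  have hm : (((-A i j).toNat : ℕ) : ℤ) = -A i j :=
    Int.toNat_of_nonneg (neg_nonneg.2 (hA.nonpos i j hij))
  set n := (-A i j).toNat
  have hej : D.e j ∈ D.swap.weightSpace (-Finsupp.single j 1) := by
    rw [mem_weightSpace_swap, neg_neg]
    exact D.e_mem_weightSpace j
  have hz := D.swap.f_pow_mem_weightSpace i (n + 1) hej
  rw [mem_weightSpace_swap, neg_sub, sub_neg_eq_add, swap_f] at hz
  refine hD.eq_zero_of_forall_lie_f ?_ ?_ hz fun k => ?_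
  · exact add_nonneg (smul_nonneg (Int.natCast_nonneg _) (Finsupp.single_nonneg.2 zero_le_one))
      (Finsupp.single_nonneg.2 zero_le_one)
  · intro h
    have := DFunLike.congr_fun h j
    simp [hij] at this
  · by_cases hki : k = i
    · subst hki
      have h := D.swap.e_lie_f_pow (hA.diag k) n hej
      rw [pairing_neg, pairing_single, hm, sub_self, mul_zero, Int.cast_zero, zero_smul, add_zero,
        swap_e, swap_f, ← lie_skew (D.f k) (D.e j), D.e_f_ne j k hij.symm, neg_zero, map_zero] at h
      exact h
    · rw [lie_ad_pow_of_lie_eq_zero (by rw [← lie_skew, D.e_f_ne i k (Ne.symm hki), neg_zero])]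
      by_cases hkj : k = j
      · subst hkj
        rw [← lie_skew (D.f k), D.e_f_same, map_neg, neg_eq_zero]
        have h1 : ⁅D.e i, D.H (R.coroot k)⁆ = -((A k i : ℂ) • D.e i) := by
          rw [← lie_skew, D.H_e, R.root_coroot]
        rw [ad_pow_succ_apply', h1, map_neg, map_smul, neg_eq_zero]
        rcases Nat.eq_zero_or_pos n with hn | hn
        · rw [hA.eq_zero i k (by omega), Int.cast_zero, zero_smul]
        · obtain ⟨p, hp⟩ := Nat.exists_eq_succ_of_ne_zero hn.ne'
          rw [hp, ad_pow_succ_apply', lie_self, map_zero, smul_zero]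
      · rw [← lie_skew (D.f k), D.e_f_ne j k (Ne.symm hkj), neg_zero, map_zero]

theorem IsKacMoody.lie_e_e (hD : D.IsKacMoody) (hA : IsCartanMatrix A) {i j : I}
    (hij : A i j = 0) : ⁅D.e i, D.e j⁆ = 0 := by
  have hne : i ≠ j := by
    rintro rfl
    rw [hA.diag] at hij
    omega
  simpa [hij] using hD.serre hA hne

/-- `ad e_i` is locally nilpotent: its Engel subalgebra contains the generators. -/
theorem IsKacMoody.exists_ad_e_pow_eq_zero (hD : D.IsKacMoody) (hA : IsCartanMatrix A) (i : I)
    (x : L) : ∃ n, (ad ℂ L (D.e i) ^ n) x = 0 := by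
  rw [← LieSubalgebra.mem_engel_iff]
  have h : LieSubalgebra.lieSpan ℂ L (Set.range D.e ∪ Set.range D.f ∪ Set.range D.H) ≤
      LieSubalgebra.engel ℂ (D.e i) := by
    have hH : ∀ h, D.H h ∈ LieSubalgebra.engel ℂ (D.e i) := fun h =>
      (LieSubalgebra.mem_engel_iff _ _ _).2 ⟨2, by
        rw [ad_pow_succ_apply', ← lie_skew, D.H_e, pow_one, LieAlgebra.ad_apply, lie_neg,
          lie_smul, lie_self, smul_zero, neg_zero]⟩
    rw [LieSubalgebra.lieSpan_le]
    rintro _ ((⟨j, rfl⟩ | ⟨j, rfl⟩) | ⟨h, rfl⟩)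
    · by_cases hij : i = j
      · subst hij
        exact LieSubalgebra.self_mem_engel ℂ _
      · exact (LieSubalgebra.mem_engel_iff _ _ _).2 ⟨_, hD.serre hA hij⟩
    · by_cases hij : i = j
      · subst hij
        obtain ⟨n, hn⟩ := (LieSubalgebra.mem_engel_iff _ _ _).1 (hH (R.coroot i))
        refine (LieSubalgebra.mem_engel_iff _ _ _).2 ⟨n + 1, ?_⟩
        rw [ad_pow_succ_apply', D.e_f_same, hn]
      · refine (LieSubalgebra.mem_engel_iff _ _ _).2 ⟨1, ?_⟩
        rw [pow_one, LieAlgebra.ad_apply, D.e_f_ne i j hij]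
    · exact hH h
  rw [D.lieSpan_eq_top] at h
  exact h trivial

end ChevalleyGenerators

end

end KacMoody

namespace KacMoody

noncomputable section

variable {I : Type*} [Fintype I] {A : Matrix I I ℤ} {𝔥 : Type*} [AddCommGroup 𝔥] [Module ℂ 𝔥]
  {R : Realization A 𝔥} {L : Type*} [LieRing L] [LieAlgebra ℂ L]

namespace ChevalleyGenerators

open LieAlgebra (ad)

/-! ### Roots -/

/-- The nonzero weights of `L` in the root lattice. -/
def roots (D : ChevalleyGenerators R L) : Set (I →₀ ℤ) :=
  {α | α ≠ 0 ∧ ∃ x : L, x ≠ 0 ∧ x ∈ D.weightSpace α}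

variable {D : ChevalleyGenerators R L} {α : I →₀ ℤ}

theorem neg_mem_roots_swap : -α ∈ D.swap.roots ↔ α ∈ D.roots := by
  simp only [roots, Set.mem_ofPred_eq, mem_weightSpace_swap, neg_neg, neg_ne_zero]

theorem eq_zero_of_notMem_roots (hα : α ∉ D.roots) (hα0 : α ≠ 0) {x : L}
    (hx : x ∈ D.weightSpace α) : x = 0 := by
  by_contra h
  exact hα ⟨hα0, x, h, hx⟩

theorem nonneg_or_nonpos_of_mem_roots (hα : α ∈ D.roots) : 0 ≤ α ∨ α ≤ 0 := by
  obtain ⟨hα0, x, hx0, hx⟩ := hα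
  obtain ⟨g, ⟨w, i, rfl⟩ | ⟨w, i, rfl⟩, hg0, hg⟩ := D.exists_rootWords hα0 hx0 hx
  · left
    rw [← D.eq_of_mem_weightSpace hg0 (D.wordLie_e_mem_weightSpace w i) hg]
    exact content_nonneg _
  · right
    have h := (D.mem_weightSpace_swap).1 (D.swap.wordLie_e_mem_weightSpace w i)
    rw [← D.eq_of_mem_weightSpace hg0 h hg]
    exact neg_nonpos.2 (content_nonneg _)

theorem exists_word_of_mem_roots (hα : α ∈ D.roots) (hpos : 0 ≤ α) :
    ∃ w i, D.wordLie w (D.e i) ≠ 0 ∧ content (i :: w) = α := by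
  obtain ⟨hα0, x, hx0, hx⟩ := hα
  obtain ⟨g, ⟨w, i, rfl⟩ | ⟨w, i, rfl⟩, hg0, hg⟩ := D.exists_rootWords hα0 hx0 hx
  · exact ⟨w, i, hg0, D.eq_of_mem_weightSpace hg0 (D.wordLie_e_mem_weightSpace w i) hg⟩
  · have h := (D.mem_weightSpace_swap).1 (D.swap.wordLie_e_mem_weightSpace w i)
    have h1 := D.eq_of_mem_weightSpace hg0 h hg
    rw [← h1] at hpos
    exact absurd (le_antisymm (neg_nonneg.1 hpos) (content_nonneg _)) (content_cons_ne_zero i w)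

theorem lie_wordLie_eq_zero {x y : L} {w : List I} (hxy : ⁅x, y⁆ = 0)
    (hw : ∀ k ∈ w, ⁅x, D.e k⁆ = 0) : ⁅x, D.wordLie w y⁆ = 0 := by
  induction w with
  | nil => exact hxy
  | cons k w ih =>
    rw [wordLie_cons, leibniz_lie, hw k (by simp), zero_lie, zero_add,
      ih fun k hk => hw k (List.mem_cons_of_mem _ hk), lie_zero]

/-- An iterated bracket vanishes if its letters split into two nonempty parts that are not joined in
the Dynkin diagram: `e_i` and `e_j` commute when `a_{ij} = 0`. -/
theorem IsKacMoody.wordLie_eq_zero (hD : D.IsKacMoody) (hA : IsCartanMatrix A) (T : Set I)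
    {w : List I} {i : I} (h : ∀ a ∈ i :: w, ∀ b ∈ i :: w, a ∈ T → b ∉ T → A a b = 0)
    (hT : ∃ a ∈ i :: w, a ∈ T) (hT' : ∃ b ∈ i :: w, b ∉ T) : D.wordLie w (D.e i) = 0 := by
  induction w with
  | nil => simp_all
  | cons k w ih =>
    have hsub : ∀ a ∈ i :: w, a ∈ i :: k :: w := by
      intro a ha
      simp only [List.mem_cons] at ha ⊢
      tauto
    have hk : k ∈ i :: k :: w := by simp
    rw [wordLie_cons]
    by_cases h1 : ∃ a ∈ i :: w, a ∈ T
    · by_cases h2 : ∃ b ∈ i :: w, b ∉ T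
      · rw [ih (fun a ha b hb => h a (hsub a ha) b (hsub b hb)) h1 h2, lie_zero]
      · push Not at h2
        have hkT : k ∉ T := by
          intro hkT
          obtain ⟨b, hb, hbT⟩ := hT'
          simp only [List.mem_cons] at hb h2
          rcases hb with rfl | rfl | hb
          · exact hbT (h2 _ (Or.inl rfl))
          · exact hbT hkT
          · exact hbT (h2 _ (Or.inr hb))
        have hcomm : ∀ a ∈ i :: w, ⁅D.e k, D.e a⁆ = 0 := fun a ha =>
          hD.lie_e_e hA (hA.eq_zero _ _ (h a (hsub a ha) k hk (h2 a ha) hkT))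
        exact lie_wordLie_eq_zero (hcomm i (by simp))
          fun a ha => hcomm a (List.mem_cons_of_mem _ ha)
    · push Not at h1
      have hkT : k ∈ T := by
        by_contra hkT
        obtain ⟨b, hb, hbT⟩ := hT
        simp only [List.mem_cons] at hb h1
        rcases hb with rfl | rfl | hb
        · exact h1 _ (Or.inl rfl) hbT
        · exact hkT hbT
        · exact h1 _ (Or.inr hb) hbT
      have hcomm : ∀ a ∈ i :: w, ⁅D.e k, D.e a⁆ = 0 := fun a ha =>
        hD.lie_e_e hA (h k hk a (hsub a ha) hkT (h1 a ha))
      exact lie_wordLie_eq_zero (hcomm i (by simp))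
        fun a ha => hcomm a (List.mem_cons_of_mem _ ha)

/-- The support of a positive root is connected in the Dynkin diagram. -/
theorem IsKacMoody.exists_ne_zero_of_mem_roots (hD : D.IsKacMoody) (hA : IsCartanMatrix A)
    (hα : α ∈ D.roots) (hpos : 0 ≤ α) (T : Set I) {i j : I} (hi : α i ≠ 0) (hiT : i ∈ T)
    (hj : α j ≠ 0) (hjT : j ∉ T) :
    ∃ a b, α a ≠ 0 ∧ a ∈ T ∧ α b ≠ 0 ∧ b ∉ T ∧ A a b ≠ 0 := by
  obtain ⟨w, k, hw, rfl⟩ := exists_word_of_mem_roots hα hpos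
  have hmem : ∀ a, content (k :: w) a ≠ 0 ↔ a ∈ k :: w := fun a => by
    rw [← content_apply_pos]
    exact ⟨fun h => lt_of_le_of_ne (hpos a) h.symm, ne_of_gt⟩
  by_contra! hc
  refine hw (hD.wordLie_eq_zero hA T (fun a ha b hb haT hbT => ?_) ⟨i, (hmem i).1 hi, hiT⟩
    ⟨j, (hmem j).1 hj, hjT⟩)
  exact hc a b ((hmem a).2 ha) haT ((hmem b).2 hb) hbT

/-- The only positive root that is a multiple of `α_i` is `α_i`. -/
theorem eq_single_of_mem_roots (hα : α ∈ D.roots) (hpos : 0 ≤ α) {i : I}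
    (hi : ∀ j, j ≠ i → α j = 0) : α = Finsupp.single i 1 := by
  obtain ⟨w, k, hw, rfl⟩ := exists_word_of_mem_roots hα hpos
  have hall : ∀ j ∈ k :: w, j = i := by
    intro j hj
    by_contra hji
    exact (content_apply_pos.2 hj).ne' (hi j hji)
  cases w with
  | nil => simp [hall k (by simp)]
  | cons l w =>
    refine absurd ?_ hw
    have hcomm : ∀ a ∈ k :: l :: w, ⁅D.e l, D.e a⁆ = 0 := fun a ha => by
      rw [hall a ha, hall l (by simp), lie_self]
    exact lie_wordLie_eq_zero (hcomm k (by simp))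
      fun a ha => hcomm a (List.mem_cons_of_mem _ (List.mem_cons_of_mem _ ha))

theorem single_mem_roots (hD : D.IsKacMoody) (i : I) : Finsupp.single i 1 ∈ D.roots := by
  refine ⟨by simp, D.e i, fun h => ?_, D.e_mem_weightSpace i⟩
  have h1 := D.e_f_same i
  rw [h, zero_lie] at h1
  exact R.linearIndependent_coroot.ne_zero i (hD.H_eq_zero _ h1.symm)

theorem IsKacMoody.sub_mem_roots_of_pairing_nonneg (hD : D.IsKacMoody) (hA : IsCartanMatrix A)
    (hα : α ∈ D.roots) {i : I} (hi : 0 ≤ pairing A α i) :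
    α - pairing A α i • Finsupp.single i 1 ∈ D.roots := by
  obtain ⟨hα0, x, hx0, hx⟩ := hα
  obtain ⟨n, hn⟩ := hD.exists_ad_e_pow_eq_zero hA i x
  have hm : ((pairing A α i).toNat : ℤ) = pairing A α i := Int.toNat_of_nonneg hi
  have hmem := D.f_pow_mem_weightSpace i (pairing A α i).toNat hx
  rw [hm] at hmem
  refine ⟨fun h => hα0 ?_, _, fun h =>
    hx0 (D.eq_zero_of_f_pow_eq_zero (hA.diag i) hx hn h hm.le), hmem⟩
  have h1 := congrArg (fun β => pairing A β i) (sub_eq_zero.1 h)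
  simp only [pairing_smul, pairing_single, hA.diag] at h1
  have h2 : pairing A α i = 0 := by omega
  rw [h2, zero_smul, sub_zero] at h
  exact h

/-- The root system is invariant under the simple reflections. -/
theorem IsKacMoody.reflection_mem_roots (hD : D.IsKacMoody) (hA : IsCartanMatrix A)
    (hα : α ∈ D.roots) (i : I) : α - pairing A α i • Finsupp.single i 1 ∈ D.roots := by
  rcases le_total 0 (pairing A α i) with hi | hi
  · exact hD.sub_mem_roots_of_pairing_nonneg hA hα hi
  · have h := hD.swap.sub_mem_roots_of_pairing_nonneg hA (neg_mem_roots_swap.2 hα) (i := i)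
      (by rw [pairing_neg]; omega)
    rw [← neg_mem_roots_swap]
    convert h using 1
    rw [pairing_neg, neg_smul]
    abel

theorem IsKacMoody.lie_e_ne_zero (hD : D.IsKacMoody) (hA : IsCartanMatrix A) {i : I} {x : L}
    (hx : x ∈ D.weightSpace α) (hx0 : x ≠ 0) (hi : pairing A α i < 0) : ⁅D.e i, x⁆ ≠ 0 := by
  intro h
  obtain ⟨n, hn⟩ := hD.swap.exists_ad_e_pow_eq_zero hA i x
  refine hx0 (D.swap.eq_zero_of_f_pow_eq_zero (k := 1) (hA.diag i) (α := -α)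
    (D.mem_weightSpace_swap.2 (by rwa [neg_neg])) hn (by simpa using h) ?_)
  rw [pairing_neg]
  push_cast
  omega

theorem IsKacMoody.add_mem_roots (hD : D.IsKacMoody) (hA : IsCartanMatrix A) {i : I}
    (hα : α ∈ D.roots) (hpos : 0 ≤ α) (hi : pairing A α i < 0) :
    α + Finsupp.single i 1 ∈ D.roots := by
  obtain ⟨hα0, x, hx0, hx⟩ := hα
  refine ⟨fun h => hα0 (le_antisymm ?_ hpos), _, hD.lie_e_ne_zero hA hx hx0 hi,
    D.lie_e_mem_weightSpace i hx⟩
  exact (le_add_of_nonneg_right (Finsupp.single_nonneg.2 zero_le_one)).trans h.le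

theorem IsKacMoody.lie_f_eq_zero (hD : D.IsKacMoody) (hA : IsCartanMatrix A) {i : I} {x : L}
    (hx : x ∈ D.weightSpace α) (hi : pairing A α i = 0) (he : ⁅D.e i, x⁆ = 0) :
    ⁅D.f i, x⁆ = 0 := by
  by_contra h0
  refine hD.lie_e_ne_zero hA (D.lie_f_mem_weightSpace i hx) h0 (i := i) ?_ ?_
  · rw [pairing_sub, pairing_single, hi, hA.diag]
    norm_num
  · rw [leibniz_lie, D.e_f_same, hx, R.weight_coroot, hi, he]
    simp

/-- A positive root orthogonal to the simple coroots in its support is not maximal among the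
positive roots with that support: a root vector would generate an ideal that meets `𝔥`
trivially. -/
theorem IsKacMoody.exists_add_mem_roots (hD : D.IsKacMoody) (hA : IsCartanMatrix A)
    (hα : α ∈ D.roots) (hpos : 0 ≤ α) (h : ∀ i, α i ≠ 0 → pairing A α i = 0) :
    ∃ i, α i ≠ 0 ∧ α + Finsupp.single i 1 ∈ D.roots := by
  by_contra! hc
  have hα' := hα
  obtain ⟨hα0, x, hx0, hx⟩ := hα'
  refine hx0 (hD.eq_zero_of_forall_lie_f hpos hα0 hx fun i => ?_)
  by_cases hi : α i = 0
  · refine eq_zero_of_notMem_roots (α := α - Finsupp.single i 1) (fun hr => ?_) (fun h0 => ?_)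
      (D.lie_f_mem_weightSpace i hx)
    · rcases nonneg_or_nonpos_of_mem_roots hr with h1 | h1
      · have := h1 i
        simp [hi] at this
      · refine hα0 (Finsupp.ext fun j => ?_)
        by_cases hj : j = i
        · rw [hj, hi, Finsupp.zero_apply]
        · have h2 := h1 j
          have h3 := hpos j
          simp [Ne.symm hj] at h2 h3
          rw [Finsupp.zero_apply]
          omega
    · have := DFunLike.congr_fun h0 i
      simp [hi] at this
  · refine hD.lie_f_eq_zero hA hx (h i hi) (eq_zero_of_notMem_roots (hc i hi) (fun h0 => ?_)
      (D.lie_e_mem_weightSpace i hx))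
    exact hα0 (le_antisymm
      ((le_add_of_nonneg_right (Finsupp.single_nonneg.2 zero_le_one)).trans h0.le) hpos)

/-! ### Elements of the fundamental set are roots -/

/-- A nonzero `α ≥ 0` in the root lattice with connected support, such that `⟨α, α_i^∨⟩ ≤ 0` for
all `i`, is a root. A maximal root `β ≤ α` has the support of `α`. Were `β ≠ α`, comparison of the
coefficients of `α - β` with those of `β` would show `⟨β, α_i^∨⟩ = 0` on the support, which
`IsKacMoody.exists_add_mem_roots` excludes. -/
theorem IsKacMoody.mem_roots_of_pairing_nonpos (hD : D.IsKacMoody) (hA : IsCartanMatrix A)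
    (hpos : 0 ≤ α) (hα0 : α ≠ 0) (hle : ∀ i, pairing A α i ≤ 0)
    (hconn : ∀ (T : Set I) (i j : I), α i ≠ 0 → i ∈ T → α j ≠ 0 → j ∉ T →
      ∃ a b, α a ≠ 0 ∧ a ∈ T ∧ α b ≠ 0 ∧ b ∉ T ∧ A a b ≠ 0) : α ∈ D.roots := by
  classical
  have hpos' : ∀ i, 0 ≤ α i := hpos
  have hex : ({β | β ∈ D.roots ∧ 0 ≤ β ∧ β ≤ α} : Set (I →₀ ℤ)).Nonempty := by
    obtain ⟨i, hi⟩ := Finsupp.ne_iff.1 hα0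
    refine ⟨Finsupp.single i 1, single_mem_roots hD i, Finsupp.single_nonneg.2 zero_le_one,
      fun j => ?_⟩
    rw [Finsupp.single_apply]
    rw [Finsupp.zero_apply] at hi
    have := hpos' i
    split_ifs with hij
    · subst hij
      omega
    · exact hpos' j
  have hfin : ({β | β ∈ D.roots ∧ 0 ≤ β ∧ β ≤ α} : Set (I →₀ ℤ)).Finite :=
    (Set.finite_Icc 0 α).subset fun β hβ => hβ.2
  obtain ⟨β, ⟨hβ, hβ0, hβα⟩, hmax⟩ := hfin.exists_maximal hex
  have hβ0' : ∀ i, 0 ≤ β i := hβ0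
  have hβα' : ∀ i, β i ≤ α i := hβα
  have hnot : ∀ i, β i < α i → β + Finsupp.single i 1 ∉ D.roots := by
    intro i hi hr
    have h1 : β ≤ β + Finsupp.single i 1 :=
      le_add_of_nonneg_right (Finsupp.single_nonneg.2 zero_le_one)
    have h2 := hmax ⟨hr, hβ0.trans h1, fun j => ?_⟩ h1 i
    · simp at h2
    · rw [Finsupp.add_apply, Finsupp.single_apply]
      have := hβα' j
      split_ifs with hij
      · subst hij
        omega
      · omega
  have hpair : ∀ i, β i < α i → 0 ≤ pairing A β i := by
    intro i hi
    by_contra! hlt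
    exact hnot i hi (hD.add_mem_roots hA hβ hβ0 hlt)
  have hsupp : ∀ i, α i ≠ 0 → β i ≠ 0 := by
    intro i hi hβi
    obtain ⟨k, hk⟩ := Finsupp.ne_iff.1 hβ.1
    rw [Finsupp.zero_apply] at hk
    obtain ⟨a, b, ha, haT, hb, hbT, hab⟩ := hconn {j | β j = 0} i k hi hβi
      (fun h => hk (le_antisymm (h ▸ hβα' k) (hβ0' k))) hk
    have haT' : β a = 0 := haT
    have hbT' : β b ≠ 0 := hbT
    have hne : a ≠ b := by
      rintro rfl
      exact hbT haT
    refine absurd (hpair a ?_) (not_le.2 ?_)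
    · have := hpos' a
      omega
    · refine Finset.sum_neg' (fun j _ => ?_) ⟨b, Finset.mem_univ _, ?_⟩
      · by_cases hja : a = j
        · rw [← hja, haT', zero_mul]
        · exact mul_nonpos_of_nonneg_of_nonpos (hβ0' j) (hA.nonpos a j hja)
      · exact mul_neg_of_pos_of_neg (lt_of_le_of_ne (hβ0' b) hbT'.symm)
          (lt_of_le_of_ne (hA.nonpos a b hne) hab)
  by_contra hα
  have hne : β ≠ α := fun h => hα (h ▸ hβ)
  obtain ⟨k, hk⟩ := Finsupp.ne_iff.1 hne
  have hk' : β k < α k := lt_of_le_of_ne (hβα' k) hk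
  -- `m` maximizes the ratio of the coefficients of `α - β` and `β`.
  obtain ⟨m, hm, hmmax⟩ := Finset.exists_max_image (Finset.univ.filter fun i => α i ≠ 0)
    (fun i => ((α i - β i : ℤ) : ℚ) / β i) ⟨k, by
      have := hβ0' k
      simp only [Finset.mem_filter, Finset.mem_univ, true_and]
      omega⟩
  simp only [Finset.mem_filter, Finset.mem_univ, true_and] at hm hmmax
  have hβpos : ∀ i, α i ≠ 0 → 0 < β i := fun i hi => lt_of_le_of_ne (hβ0' i) (hsupp i hi).symm
  have hratio : ∀ i, α i ≠ 0 → (α i - β i) * β m ≤ (α m - β m) * β i := by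
    intro i hi
    have h := hmmax i hi
    rw [div_le_div_iff₀ (by exact_mod_cast hβpos i hi) (by exact_mod_cast hβpos m hm)] at h
    exact_mod_cast h
  have hαk : α k ≠ 0 := by
    have := hβ0' k
    omega
  have hp : 0 < α m - β m := by
    have h1 := hratio k hαk
    have h2 : 0 < (α k - β k) * β m := mul_pos (by omega) (hβpos m hm)
    by_contra! h3
    exact (h2.trans_le h1).not_ge (mul_nonpos_of_nonpos_of_nonneg h3 (hβ0' k))
  -- The vector `v ≥ 0` vanishes at `m`.
  set v : I →₀ ℤ := (α m - β m) • β - β m • (α - β) with hv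
  have hv0 : ∀ i, 0 ≤ v i := by
    intro i
    by_cases hi : α i = 0
    · have h1 : β i = 0 := le_antisymm (hi ▸ hβα' i) (hβ0' i)
      simp [hv, hi, h1]
    · have := hratio i hi
      simp only [hv, Finsupp.sub_apply, Finsupp.smul_apply, smul_eq_mul]
      linarith
  have hvm : v m = 0 := by
    simp only [hv, Finsupp.sub_apply, Finsupp.smul_apply, smul_eq_mul]
    ring
  have hlt : ∀ i, α i ≠ 0 → v i = 0 → β i < α i := by
    intro i hi hvi
    simp only [hv, Finsupp.sub_apply, Finsupp.smul_apply, smul_eq_mul] at hvi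
    have h1 : 0 < (α m - β m) * β i := mul_pos hp (hβpos i hi)
    have h2 : 0 < β m * (α i - β i) := by linarith
    by_contra! h3
    exact h2.not_ge (mul_nonpos_of_nonneg_of_nonpos (hβ0' m) (sub_nonpos.2 h3))
  have hterm : ∀ i, v i = 0 → ∀ j, v j * A i j ≤ 0 := by
    intro i hvi j
    by_cases hij : i = j
    · rw [← hij, hvi, zero_mul]
    · exact mul_nonpos_of_nonneg_of_nonpos (hv0 j) (hA.nonpos i j hij)
  have hpv : ∀ i, α i ≠ 0 → v i = 0 → pairing A β i = 0 ∧ pairing A v i = 0 := by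
    intro i hi hvi
    have h1 : pairing A v i ≤ 0 := Finset.sum_nonpos fun j _ => hterm i hvi j
    have h2 : pairing A v i = (α m - β m) * pairing A β i
        - β m * (pairing A α i - pairing A β i) := by
      rw [hv, pairing_sub, pairing_smul, pairing_smul, pairing_sub]
    have h3 := hpair i (hlt i hi hvi)
    have h4 : 0 ≤ (α m - β m) * pairing A β i := mul_nonneg hp.le h3
    have h5 : β m * (pairing A α i - pairing A β i) ≤ 0 :=
      mul_nonpos_of_nonneg_of_nonpos (hβ0' m) (by have := hle i; omega)
    have h6 : (α m - β m) * pairing A β i = 0 := by omega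
    exact ⟨(mul_eq_zero.1 h6).resolve_left hp.ne', by omega⟩
  have hall : ∀ i, α i ≠ 0 → v i = 0 := by
    by_contra! hc
    obtain ⟨j, hj, hvj⟩ := hc
    obtain ⟨a, b, ha, haT, hb, hbT, hab⟩ := hconn {i | v i = 0} m j hm hvm hj hvj
    have h1 := (Finset.sum_eq_zero_iff_of_nonpos fun j _ => hterm a haT j).1 (hpv a ha haT).2 b
      (Finset.mem_univ _)
    exact (mul_ne_zero hbT hab) h1
  have hβne : ∀ i, β i ≠ 0 → α i ≠ 0 := by
    intro i hi
    have h1 := hβ0' i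
    have h2 := hβα' i
    omega
  obtain ⟨i, hi, hr⟩ := hD.exists_add_mem_roots hA hβ hβ0
    fun i hi => (hpv i (hβne i hi) (hall i (hβne i hi))).1
  exact hnot i (hlt i (hβne i hi) (hall i (hβne i hi))) hr

end ChevalleyGenerators

end

end KacMoody

/-! ### Folding -/

noncomputable section

theorem Finset.abs_sum_of_mul_nonneg {ι : Type*} (s : Finset ι) (f : ι → ℤ)
    (h : ∀ i ∈ s, ∀ j ∈ s, 0 ≤ f i * f j) : |∑ i ∈ s, f i| = ∑ i ∈ s, |f i| := by
  by_cases hpos : ∀ i ∈ s, 0 ≤ f i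
  · rw [abs_of_nonneg (Finset.sum_nonneg hpos)]
    exact Finset.sum_congr rfl fun i hi => (abs_of_nonneg (hpos i hi)).symm
  · push Not at hpos
    obtain ⟨k, hk, hfk⟩ := hpos
    have hneg : ∀ i ∈ s, f i ≤ 0 := fun i hi =>
      nonpos_of_mul_nonneg_right (h k hk i hi) hfk
    rw [abs_of_nonpos (Finset.sum_nonpos hneg), ← Finset.sum_neg_distrib]
    exact Finset.sum_congr rfl fun i hi => (abs_of_nonpos (hneg i hi)).symm

variable {I : Type*}

open KacMoody

section CartanCounterpart

variable {B : Matrix I I ℤ} {σ : Equiv.Perm I}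

theorem IsSkewSymmetrizable.eq_zero (hB : IsSkewSymmetrizable B) {i j : I} (h : B i j = 0) :
    B j i = 0 := by
  obtain ⟨d, hd, hdB⟩ := hB
  have h1 := hdB i j
  rw [h, mul_zero, zero_eq_neg, mul_eq_zero] at h1
  exact h1.resolve_left (hd j).ne'

theorem foldedMatrix_mk [Fintype I] (h : IsMatrixAut B σ) (x : Orbit σ) (j : I) :
    foldedMatrix B σ h x (Orbit.mk σ j) =
      ∑ s ∈ Finset.univ.filter (fun s => Orbit.mk σ s = x), B s j := rfl

theorem foldRootLattice_single (i : I) (n : ℤ) :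
    foldRootLattice σ (Finsupp.single i n) = Finsupp.single (Orbit.mk σ i) n :=
  Finsupp.mapDomain_single

theorem foldRootLattice_apply [Fintype I] (α : I →₀ ℤ) (x : Orbit σ) :
    foldRootLattice σ α x = ∑ s ∈ Finset.univ.filter (fun s => Orbit.mk σ s = x), α s := by
  induction α using Finsupp.induction_linear with
  | zero => simp
  | add α β hα hβ => simp only [map_add, Finsupp.add_apply, hα, hβ, Finset.sum_add_distrib]
  | single i n =>
    rw [foldRootLattice_single, Finsupp.single_apply, Finset.sum_filter]
    rw [Finset.sum_eq_single i]
    · simp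
    · intro j _ hj
      simp [Ne.symm hj]
    · simp

theorem foldRootLattice_nonneg [Fintype I] {α : I →₀ ℤ} (hα : 0 ≤ α) :
    0 ≤ foldRootLattice σ α := fun x => by
  rw [foldRootLattice_apply]
  exact Finset.sum_nonneg fun i _ => hα i

theorem foldRootLattice_apply_ne_zero_iff [Fintype I] {α : I →₀ ℤ} (hα : 0 ≤ α) {x : Orbit σ} :
    foldRootLattice σ α x ≠ 0 ↔ ∃ i, Orbit.mk σ i = x ∧ α i ≠ 0 := by
  rw [foldRootLattice_apply, Ne, Finset.sum_eq_zero_iff_of_nonneg fun i _ => hα i]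
  simp

variable [DecidableEq I]

theorem cartanCounterpart_of_ne {i j : I} (hij : i ≠ j) : cartanCounterpart B i j = -|B i j| := by
  simp [cartanCounterpart, hij]

theorem cartanCounterpart_self (i : I) : cartanCounterpart B i i = 2 := by
  simp [cartanCounterpart]

theorem isCartanMatrix_cartanCounterpart (hB : ∀ i j, B i j = 0 → B j i = 0) :
    IsCartanMatrix (cartanCounterpart B) where
  diag := cartanCounterpart_self
  nonpos i j hij := by
    rw [cartanCounterpart_of_ne hij]
    exact neg_nonpos.2 (abs_nonneg _)
  eq_zero i j h := by
    by_cases hij : i = j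
    · subst hij
      exact h
    · rw [cartanCounterpart_of_ne hij, neg_eq_zero, abs_eq_zero] at h
      rw [cartanCounterpart_of_ne (Ne.symm hij), hB i j h, abs_zero, neg_zero]

theorem IsAdmissible.cartanCounterpart_eq_zero (hσ : IsAdmissible B σ) {i j : I} (hij : i ≠ j)
    (h : Orbit.mk σ i = Orbit.mk σ j) : cartanCounterpart B i j = 0 := by
  rw [cartanCounterpart_of_ne hij, hσ.eq_zero i j ((Orbit.mk_eq_mk σ i j).1 h), abs_zero, neg_zero]

theorem cartanCounterpart_nonpos {s b : I} (h : Orbit.mk σ s ≠ Orbit.mk σ b) :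
    cartanCounterpart B s b ≤ 0 := by
  rw [cartanCounterpart_of_ne (fun hsb => h (congrArg (Orbit.mk σ) hsb))]
  exact neg_nonpos.2 (abs_nonneg _)

end CartanCounterpart

section Fold

variable [Fintype I] [DecidableEq I] {B : Matrix I I ℤ} {σ : Equiv.Perm I}

/-- The Cartan counterpart commutes with folding, since the entries `b_{sj}`, for `s` in an orbit,
have the same sign. -/
theorem IsAdmissible.cartanCounterpart_foldedMatrix (hσ : IsAdmissible B σ) (x : Orbit σ) (j : I) :
    cartanCounterpart (foldedMatrix B σ hσ.isAut) x (Orbit.mk σ j) =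
      ∑ s ∈ Finset.univ.filter (fun s => Orbit.mk σ s = x), cartanCounterpart B s j := by
  by_cases hx : x = Orbit.mk σ j
  · subst hx
    rw [cartanCounterpart_self, Finset.sum_eq_single j, cartanCounterpart_self]
    · intro s hs hsj
      exact hσ.cartanCounterpart_eq_zero hsj (Finset.mem_filter.1 hs).2
    · simp
  · rw [cartanCounterpart_of_ne hx, foldedMatrix_mk, Finset.abs_sum_of_mul_nonneg,
      ← Finset.sum_neg_distrib]
    · refine Finset.sum_congr rfl fun s hs => (cartanCounterpart_of_ne ?_).symm
      rintro rfl
      exact hx (Finset.mem_filter.1 hs).2.symm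
    · intro s hs t ht
      refine hσ.mul_nonneg s t j ((Orbit.mk_eq_mk σ s t).1 ?_)
      rw [(Finset.mem_filter.1 hs).2, (Finset.mem_filter.1 ht).2]

theorem IsAdmissible.cartanCounterpart_foldedMatrix_eq_zero_iff (hσ : IsAdmissible B σ)
    {x : Orbit σ} {j : I} (hx : x ≠ Orbit.mk σ j) :
    cartanCounterpart (foldedMatrix B σ hσ.isAut) x (Orbit.mk σ j) = 0 ↔
      ∀ s, Orbit.mk σ s = x → cartanCounterpart B s j = 0 := by
  rw [hσ.cartanCounterpart_foldedMatrix, Finset.sum_eq_zero_iff_of_nonpos]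
  · simp
  · intro s hs
    refine cartanCounterpart_nonpos (σ := σ) ?_
    rwa [(Finset.mem_filter.1 hs).2]

theorem IsAdmissible.isCartanMatrix_fold (hσ : IsAdmissible B σ) (hB : IsSkewSymmetrizable B) :
    IsCartanMatrix (cartanCounterpart (foldedMatrix B σ hσ.isAut)) where
  diag := cartanCounterpart_self
  nonpos x y hxy := by
    rw [cartanCounterpart_of_ne hxy]
    exact neg_nonpos.2 (abs_nonneg _)
  eq_zero x y h := by
    obtain ⟨i, rfl⟩ := Quotient.exists_rep x
    obtain ⟨j, rfl⟩ := Quotient.exists_rep y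
    change cartanCounterpart _ (Orbit.mk σ i) (Orbit.mk σ j) = 0 at h
    change cartanCounterpart _ (Orbit.mk σ j) (Orbit.mk σ i) = 0
    have hA := isCartanMatrix_cartanCounterpart fun i j => hB.eq_zero (i := i) (j := j)
    by_cases hij : Orbit.mk σ i = Orbit.mk σ j
    · rw [hij] at h ⊢
      exact h
    · rw [hσ.cartanCounterpart_foldedMatrix_eq_zero_iff (Ne.symm hij)]
      intro s hs
      rw [← hs] at h hij
      exact hA.eq_zero _ _ ((hσ.cartanCounterpart_foldedMatrix_eq_zero_iff hij).1 h i rfl)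

/-- The coroot of an orbit corresponds to the sum of the coroots of its elements. -/
theorem IsAdmissible.pairing_foldRootLattice (hσ : IsAdmissible B σ) (α : I →₀ ℤ) (x : Orbit σ) :
    pairing (cartanCounterpart (foldedMatrix B σ hσ.isAut)) (foldRootLattice σ α) x =
      ∑ s ∈ Finset.univ.filter (fun s => Orbit.mk σ s = x), pairing (cartanCounterpart B) α s := by
  induction α using Finsupp.induction_linear with
  | zero => simp [pairing]
  | add α β hα hβ => simp only [map_add, pairing_add, hα, hβ, Finset.sum_add_distrib]
  | single i n =>
    have h : ∀ {J : Type _} (j : J), Finsupp.single j n = n • Finsupp.single j (1 : ℤ) :=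
      fun j => by simp
    rw [foldRootLattice_single, h, h, pairing_smul, pairing_single,
      hσ.cartanCounterpart_foldedMatrix, Finset.mul_sum]
    exact Finset.sum_congr rfl fun s _ => by rw [pairing_smul, pairing_single]

theorem KacMoody.pairing_sum (A : Matrix I I ℤ) (s : Finset I) (c : I → ℤ) (i : I) :
    pairing A (∑ j ∈ s, c j • Finsupp.single j 1) i = ∑ j ∈ s, c j * A i j := by
  induction s using Finset.induction_on with
  | empty => simp [pairing]
  | insert a s ha ih =>
    rw [Finset.sum_insert ha, Finset.sum_insert ha, pairing_add, ih, pairing_smul, pairing_single]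

namespace KacMoody.ChevalleyGenerators

/-- The product of the simple reflections at pairwise orthogonal simple roots preserves the root
system. -/
theorem IsKacMoody.prod_reflection_mem_roots {A : Matrix I I ℤ} {𝔥 : Type*} [AddCommGroup 𝔥]
    [Module ℂ 𝔥] {R : Realization A 𝔥} {L : Type*} [LieRing L] [LieAlgebra ℂ L]
    {D : ChevalleyGenerators R L} (hD : D.IsKacMoody) (hA : IsCartanMatrix A) {α : I →₀ ℤ}
    (hα : α ∈ D.roots) (s : Finset I) (hs : ∀ i ∈ s, ∀ j ∈ s, i ≠ j → A i j = 0) :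
    α - ∑ i ∈ s, pairing A α i • Finsupp.single i 1 ∈ D.roots := by
  induction s using Finset.induction_on with
  | empty => simpa using hα
  | insert a s ha ih =>
    have h := hD.reflection_mem_roots hA (ih fun i hi j hj => hs i (Finset.mem_insert_of_mem hi) j
      (Finset.mem_insert_of_mem hj)) a
    have h1 : pairing A (α - ∑ i ∈ s, pairing A α i • Finsupp.single i 1) a = pairing A α a := by
      rw [pairing_sub, pairing_sum, Finset.sum_eq_zero, sub_zero]
      intro j hj
      rw [hs a (Finset.mem_insert_self _ _) j (Finset.mem_insert_of_mem hj)
        (ne_of_mem_of_not_mem hj ha).symm, mul_zero]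
    rw [h1, sub_sub, add_comm] at h
    rwa [Finset.sum_insert ha]

variable {𝔥 : Type*} [AddCommGroup 𝔥] [Module ℂ 𝔥] {R : Realization (cartanCounterpart B) 𝔥}
  {L : Type*} [LieRing L] [LieAlgebra ℂ L] {D : ChevalleyGenerators R L}
  (hσ : IsAdmissible B σ) {𝔥' : Type*} [AddCommGroup 𝔥'] [Module ℂ 𝔥']
  {R' : Realization (cartanCounterpart (foldedMatrix B σ hσ.isAut)) 𝔥'}
  {L' : Type*} [LieRing L'] [LieAlgebra ℂ L'] {D' : ChevalleyGenerators R' L'}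

/-- The case in which the image of a positive root lies in the fundamental set. -/
theorem IsKacMoody.fold_mem_roots_of_pairing_nonpos (hD : D.IsKacMoody) (hD' : D'.IsKacMoody)
    (hB : IsSkewSymmetrizable B) {α : I →₀ ℤ} (hα : α ∈ D.roots) (hpos : 0 ≤ α)
    (hle : ∀ x, pairing (cartanCounterpart (foldedMatrix B σ hσ.isAut))
      (foldRootLattice σ α) x ≤ 0) : foldRootLattice σ α ∈ D'.roots := by
  have hA := isCartanMatrix_cartanCounterpart fun i j => hB.eq_zero (i := i) (j := j)
  refine hD'.mem_roots_of_pairing_nonpos (hσ.isCartanMatrix_fold hB) (foldRootLattice_nonneg hpos)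
    ?_ hle ?_
  · obtain ⟨i, hi⟩ := Finsupp.ne_iff.1 hα.1
    exact Finsupp.ne_iff.2 ⟨_, (foldRootLattice_apply_ne_zero_iff hpos).2 ⟨i, rfl, hi⟩⟩
  · intro T x y hx hxT hy hyT
    obtain ⟨i, rfl, hi⟩ := (foldRootLattice_apply_ne_zero_iff hpos).1 hx
    obtain ⟨j, rfl, hj⟩ := (foldRootLattice_apply_ne_zero_iff hpos).1 hy
    obtain ⟨a, b, ha, haT, hb, hbT, hab⟩ :=
      hD.exists_ne_zero_of_mem_roots hA hα hpos (Orbit.mk σ ⁻¹' T) hi hxT hj hyT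
    refine ⟨_, _, (foldRootLattice_apply_ne_zero_iff hpos).2 ⟨a, rfl, ha⟩, haT,
      (foldRootLattice_apply_ne_zero_iff hpos).2 ⟨b, rfl, hb⟩, hbT, fun h => hab ?_⟩
    have hne : Orbit.mk σ a ≠ Orbit.mk σ b := fun h1 => hbT (h1 ▸ haT : Orbit.mk σ b ∈ T)
    exact (hσ.cartanCounterpart_foldedMatrix_eq_zero_iff hne).1 h a rfl

/-- Positive roots fold to roots, by induction on the height. -/
theorem IsKacMoody.fold_mem_roots_of_nonneg (hD : D.IsKacMoody) (hD' : D'.IsKacMoody)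
    (hB : IsSkewSymmetrizable B) {α : I →₀ ℤ} (hα : α ∈ D.roots) (hpos : 0 ≤ α) :
    foldRootLattice σ α ∈ D'.roots := by
  have hA := isCartanMatrix_cartanCounterpart fun i j => hB.eq_zero (i := i) (j := j)
  have hA' := hσ.isCartanMatrix_fold hB
  induction hn : (∑ i, α i).toNat using Nat.strong_induction_on generalizing α with
  | _ n ih =>
  by_cases hle : ∀ x, pairing (cartanCounterpart (foldedMatrix B σ hσ.isAut))
      (foldRootLattice σ α) x ≤ 0
  · exact hD.fold_mem_roots_of_pairing_nonpos hσ hD' hB hα hpos hle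
  push Not at hle
  obtain ⟨x, hx⟩ := hle
  set p := pairing (cartanCounterpart (foldedMatrix B σ hσ.isAut)) (foldRootLattice σ α) x with hp
  have hpsum := hσ.pairing_foldRootLattice α x
  rw [← hp] at hpsum
  set s : Finset I := Finset.univ.filter (fun s => Orbit.mk σ s = x) with hs
  have hsx : ∀ {i}, i ∈ s ↔ Orbit.mk σ i = x := by simp [hs]
  -- The reflection at the orbit `x` lifts to the product of the reflections at its elements.
  set β := α - ∑ i ∈ s, pairing (cartanCounterpart B) α i • Finsupp.single i 1 with hβ
  have hβroot : β ∈ D.roots := hD.prod_reflection_mem_roots hA hα s fun i hi j hj hij =>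
    hσ.cartanCounterpart_eq_zero hij ((hsx.1 hi).trans (hsx.1 hj).symm)
  have hβα : ∀ i, Orbit.mk σ i ≠ x → β i = α i := by
    intro i hi
    rw [hβ, Finsupp.sub_apply, Finsupp.finsetSum_apply, Finset.sum_eq_zero, sub_zero]
    intro j hj
    have hji : j ≠ i := by
      rintro rfl
      exact hi (hsx.1 hj)
    simp [hji]
  have hβfold : foldRootLattice σ β = foldRootLattice σ α - p • Finsupp.single x 1 := by
    rw [hβ, map_sub, map_sum, hpsum, Finset.sum_smul]
    congr 1
    refine Finset.sum_congr rfl fun i hi => ?_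
    rw [map_smul, foldRootLattice_single, hsx.1 hi]
  have hheight : ∑ i, β i = ∑ i, α i - p := by
    rw [hpsum, hβ]
    simp only [Finsupp.sub_apply, Finset.sum_sub_distrib, Finsupp.finsetSum_apply]
    rw [Finset.sum_comm]
    congr 1
    refine Finset.sum_congr rfl fun j _ => ?_
    simp [Finsupp.single_apply]
  rcases nonneg_or_nonpos_of_mem_roots hβroot with hβpos | hβneg
  · have h1 : 0 ≤ ∑ i, β i := Finset.sum_nonneg fun i _ => hβpos i
    have h2 := ih _ (by omega) hβroot hβpos rfl
    have h3 := hD'.reflection_mem_roots hA' h2 x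
    have h4 : pairing (cartanCounterpart (foldedMatrix B σ hσ.isAut)) (foldRootLattice σ β) x
        = -p := by
      rw [hβfold, pairing_sub, pairing_smul, pairing_single, hA'.diag, ← hp]
      ring
    rwa [h4, hβfold, neg_smul, sub_neg_eq_add, sub_add_cancel] at h3
  · -- A positive root made negative is supported on the orbit `x`, hence simple.
    have hsupp : ∀ i, α i ≠ 0 → Orbit.mk σ i = x := by
      intro i hi
      by_contra hix
      have h1 := hβα i hix
      have h2 : β i ≤ 0 := hβneg i
      have h3 : 0 ≤ α i := hpos i
      omega
    obtain ⟨k, hk⟩ := Finsupp.ne_iff.1 hα.1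
    have hsingle : α = Finsupp.single k 1 := by
      refine eq_single_of_mem_roots hα hpos fun j hjk => ?_
      by_contra hj
      obtain ⟨a, b, ha, haT, hb, hbT, hab⟩ :=
        hD.exists_ne_zero_of_mem_roots hA hα hpos {k} hk rfl hj hjk
      have hne : a ≠ b := by
        rintro rfl
        exact hbT haT
      exact hab (hσ.cartanCounterpart_eq_zero hne ((hsupp a ha).trans (hsupp b hb).symm))
    rw [hsingle, foldRootLattice_single]
    exact single_mem_roots hD' _

theorem IsKacMoody.fold_mem_roots (hD : D.IsKacMoody) (hD' : D'.IsKacMoody)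
    (hB : IsSkewSymmetrizable B) {α : I →₀ ℤ} (hα : α ∈ D.roots) :
    foldRootLattice σ α ∈ D'.roots := by
  rcases nonneg_or_nonpos_of_mem_roots hα with hpos | hneg
  · exact hD.fold_mem_roots_of_nonneg hσ hD' hB hα hpos
  · rw [← neg_mem_roots_swap, ← map_neg]
    exact hD.swap.fold_mem_roots_of_nonneg hσ hD'.swap hB (neg_mem_roots_swap.2 hα)
      (neg_nonneg.2 hneg)

end KacMoody.ChevalleyGenerators

end Fold

end

theorem mainTheorem4 {I : Type*} [Fintype I] [DecidableEq I]
    (B : Matrix I I ℤ) (hB : IsSkewSymmetrizable B)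
    (σ : Equiv.Perm I) (hσ : IsAdmissible B σ)
    {𝔥 : Type*} [AddCommGroup 𝔥] [Module ℂ 𝔥]
    (R : KacMoody.Realization (cartanCounterpart B) 𝔥)
    {𝔥' : Type*} [AddCommGroup 𝔥'] [Module ℂ 𝔥']
    (R' : KacMoody.Realization (cartanCounterpart (foldedMatrix B σ hσ.isAut)) 𝔥')
    (α : I →₀ ℤ) (hα : α ∈ R.rootSystem) :
    foldRootLattice σ α ∈ R'.rootSystem :=
  R.isKacMoody_generators.fold_mem_roots hσ R'.isKacMoody_generators hB hα
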